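/- **Setting.** Let $\mathcal S$ be a nonempty finite set. For every value $\alpha$ of a set of parameters let $R^\alpha_{x\to y}\ge 0$ ($x\ne y$ in $\mathcal S$) be transition rates such that $R^\alpha_{x\to y}\neq 0$ implies $R^\alpha_{y\to x}\ne 0$ and such that any two distinct states are connected by a sequence of transitions with nonvanishing rates. Put $\lambda^\alpha_x=\sum_{y\ne x}R^\alpha_{x\to y}$, and let $\rho^\alpha$ be the unique stationary probability distribution, i.e. $\sum_{y\ne x}\rho^\alpha_yR^\alpha_{y\to x}=\lambda^\alpha_x\rho^\alpha_x$ for all $x$. Let $\nu=\nu(\alpha)$ be a component of $\alpha$, let $H^\nu_x\in\mathbb R$ be the energy of the state $x$, and fix a reference inverse temperature $\beta>0$. Whenever $R^\alpha_{x\to y}\ne0$, let $\theta^\alpha_{x\to y}=\log(R^\alpha_{x\to y}/R^\alpha_{y\to x})$ and $\psi^\alpha_{x\to y}=\theta^\alpha_{x\to y}-\beta(H^\nu_x-H^\nu_y)$. The parameters $\alpha$ are called *equilibrium parameters* if $e^{-\beta H^\nu_x}R^\alpha_{x\to y}=e^{-\beta H^\nu_y}R^\alpha_{y\to x}$ for all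 $x\neq y$. A *protocol* $\hat\alpha$ is a (not necessarily continuous) function $t\mapsto\alpha(t)$ for which there is $\tau_{\rm o}>0$ with $\alpha(t)=\alpha:=\alpha(-\tau_{\rm o})$ for $t\le-\tau_{\rm o}$ and $\alpha(t)=\alpha':=\alpha(\tau_{\rm o})$ for $t\ge\tau_{\rm o}$, and along which the rates $R^{\alpha(t)}_{x\to y}$ are measurable in $t$ and integrable on $[-\tau_{\rm o},\tau_{\rm o}]$. Its time reversal $\hat\alpha^\dagger$ is $t\mapsto\alpha(-t)$. For $\tau\ge\tau_{\rm o}$, a *path* $\hat x$ on $[-\tau,\tau]$ consists of a number $n\ge 0$ of jumps, states $x_0,\dots,x_n$ with $x_{j-1}\ne x_j$, and jump times $-\tau<t_1<\dots<t_n<\tau$; put $t_0=-\tau$, $t_{n+1}=\tau$. Define $$\mathcal T^{\hat\alpha}[\hat x]=\prod_{j=1}^nR^{\alpha(t_j)}_{x_{j-1}\to x_j}\prod_{j=0}^n\exp\Bigl[-\int_{t_j}^{t_{j+1}}\lambda^{\alpha(t)}_{x_j}\,dt\Bigr],\qquad \Psi^{\hat\alpha}[\hat x]=\sum_{j=1}^n\psi^{\alpha(t_j)}_{x_{j-1}\to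 x_j},$$ $$W^{\hat\nu}[\hat x]=\sum_{j=0}^n\bigl(H^{\nu(t_{j+1})}_{x_j}-H^{\nu(t_j)}_{x_j}\bigr),\qquad \nu(t)=\nu(\alpha(t)),$$ $$\langle f\rangle^{\hat\alpha}_{\mathrm{st}\to}=\sum_{n\ge0}\ \sum_{x_0,\dots,x_n}\ \int_{-\tau<t_1<\dots<t_n<\tau}f[\hat x]\,\rho^{\alpha(-\tau)}_{x_0}\,\mathcal T^{\hat\alpha}[\hat x]\,dt_1\cdots dt_n .$$ **Theorem 1.** There exists a real function $F(\alpha)$ of the parameters such that $F(\alpha)=-\beta^{-1}\log\sum_{x\in\mathcal S}e^{-\beta H^\nu_x}$ whenever $\alpha$ are equilibrium parameters, and such that for every protocol $\hat\alpha$, with initial and final parameters $\alpha$ and $\alpha'$, the two expectations below converge absolutely and are positive for all $\tau\ge\tau_{\rm o}$, and $$F(\alpha')-F(\alpha)=-\frac1\beta\lim_{\tau\uparrow\infty}\log\frac{\bigl\langle\exp[-(\beta W^{\hat\nu}+\Psi^{\hat\alpha})/2]\bigr\rangle^{\hat\alpha}_{\mathrm{st}\to}}{\bigl\langle\exp[-(\beta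 W^{\hat\nu^\dagger}+\Psi^{\hat\alpha^\dagger})/2]\bigr\rangle^{\hat\alpha^\dagger}_{\mathrm{st}\to}},$$ where the limit exists, and $\hat\nu$ and $\hat\nu^\dagger$ denote the $\nu$-components of $\hat\alpha$ and $\hat\alpha^\dagger$. -/

import Mathlib

open MeasureTheory Filter Topology

namespace NESS

/-- A family of Markov jump processes on the finite state space `S`, indexed by the parameters
`α : A`, together with the energies of the states and a reference inverse temperature.  The
parameter `ν` of the Hamiltonian is a component of `α`.  Diagonal values of `rate` play no role. -/
structure Model (S A N : Type*) where
  /-- `rate α x y` is the transition rate from `x` to `y` (for `x ≠ y`). -/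
  rate : A → S → S → ℝ
  rate_nonneg : ∀ α x y, x ≠ y → 0 ≤ rate α x y
  /-- A transition is possible if and only if its reverse is. -/
  rate_rev : ∀ α x y, x ≠ y → rate α x y ≠ 0 → rate α y x ≠ 0
  /-- The state space is connected by nonvanishing rates. -/
  connected : ∀ α x y, x ≠ y →
    Relation.TransGen (fun u v => u ≠ v ∧ rate α u v ≠ 0) x y
  /-- The Hamiltonian parameter, as a component of `α`. -/
  nu : A → N
  /-- `energy ν x` is the energy of the state `x`. -/
  energy : N → S → ℝ
  /-- The reference inverse temperature. -/
  beta : ℝ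
  beta_pos : 0 < beta

/-- A path of a jump process on `S`: the number of jumps, the successively visited states
`x₀, …, xₙ`, and the times `t₁, …, tₙ` of the jumps (`time j` is the time of the jump from
`state j` to `state (j + 1)`). -/
structure JumpPath (S : Type*) where
  jumps : ℕ
  state : Fin (jumps + 1) → S
  time : Fin jumps → ℝ

namespace JumpPath

variable {S : Type*}

/-- The initial state. -/
def start (ω : JumpPath S) : S := ω.state 0

/-- The times `t₀ = -τ, t₁, …, tₙ, tₙ₊₁ = τ`. -/
def node (τ : ℝ) (ω : JumpPath S) : Fin (ω.jumps + 2) → ℝ :=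
  Fin.cons (α := fun _ => ℝ) (-τ) (Fin.snoc (α := fun _ => ℝ) ω.time τ)

end JumpPath

/-- The admissible jump times `-τ < t₁ < ⋯ < tₙ < τ`. -/
def jumpTimes (τ : ℝ) (n : ℕ) : Set (Fin n → ℝ) :=
  {t | StrictMono t ∧ ∀ j, t j ∈ Set.Ioo (-τ) τ}

open Classical in
/-- The sequences of states `x₀, …, xₙ` in which consecutive states are different. -/
noncomputable def jumpStates (S : Type*) [Fintype S] (n : ℕ) : Finset (Fin (n + 1) → S) :=
  Finset.univ.filter fun x => ∀ j : Fin n, x j.castSucc ≠ x j.succ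

/-- The integral over all the paths on the time interval `[-τ, τ]`. -/
noncomputable def pathIntegral {S : Type*} [Fintype S] (τ : ℝ) (f : JumpPath S → ℝ) : ℝ :=
  ∑' n : ℕ, ∑ x ∈ jumpStates S n, ∫ t in jumpTimes τ n, f ⟨n, x, t⟩

/-- Absolute convergence of the integral over all the paths on `[-τ, τ]`. -/
def PathIntegrable {S : Type*} [Fintype S] (τ : ℝ) (f : JumpPath S → ℝ) : Prop :=
  (∀ n : ℕ, ∀ x ∈ jumpStates S n, IntegrableOn (fun t => f ⟨n, x, t⟩) (jumpTimes τ n)) ∧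
    Summable fun n : ℕ => ∑ x ∈ jumpStates S n, ∫ t in jumpTimes τ n, |f ⟨n, x, t⟩|

namespace Model

variable {S A N : Type*} [Fintype S] [DecidableEq S] (M : Model S A N)

/-- The escape rate `λ^α_x`. -/
def escapeRate (α : A) (x : S) : ℝ := ∑ y ∈ Finset.univ.erase x, M.rate α x y

/-- The transition rate matrix, acting on column vectors of probabilities. -/
def rateMatrix (α : A) : Matrix S S ℝ :=
  Matrix.of fun y x => if y = x then -M.escapeRate α x else M.rate α x y

/-- `p` is a stationary probability distribution for the parameters `α`. -/
def IsStationary (α : A) (p : S → ℝ) : Prop :=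
  (∀ x, 0 ≤ p x) ∧ ∑ x, p x = 1 ∧ Matrix.mulVec (M.rateMatrix α) p = 0

lemma mulVec_rateMatrix (α : A) (v : S → ℝ) (x : S) :
    Matrix.mulVec (M.rateMatrix α) v x =
      ∑ y ∈ Finset.univ.erase x, M.rate α y x * v y - M.escapeRate α x * v x := by
  rw [Matrix.mulVec, dotProduct, ← Finset.add_sum_erase _ _ (Finset.mem_univ x)]
  have : ∀ y ∈ Finset.univ.erase x,
      M.rateMatrix α x y * v y = M.rate α y x * v y := by
    intro y hy
    simp [rateMatrix, (Finset.ne_of_mem_erase hy).symm]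
  rw [Finset.sum_congr rfl this]
  simp [rateMatrix]
  ring

lemma sum_rateMatrix (α : A) (x : S) : ∑ y, M.rateMatrix α y x = 0 := by
  rw [← Finset.add_sum_erase _ _ (Finset.mem_univ x)]
  have : ∀ y ∈ Finset.univ.erase x, M.rateMatrix α y x = M.rate α x y := by
    intro y hy
    simp [rateMatrix, Finset.ne_of_mem_erase hy]
  rw [Finset.sum_congr rfl this]
  simp [rateMatrix, escapeRate]

lemma sum_mulVec_rateMatrix (α : A) (v : S → ℝ) :
    ∑ x, Matrix.mulVec (M.rateMatrix α) v x = 0 := by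
  simp only [Matrix.mulVec, dotProduct]
  rw [Finset.sum_comm]
  simp [← Finset.sum_mul, sum_rateMatrix]

lemma mulVec_abs (α : A) (v : S → ℝ) (hv : Matrix.mulVec (M.rateMatrix α) v = 0) :
    Matrix.mulVec (M.rateMatrix α) (fun x => |v x|) = 0 := by
  have hnn : ∀ x ∈ Finset.univ, 0 ≤ Matrix.mulVec (M.rateMatrix α) (fun x => |v x|) x := by
    intro x _
    have hx := congrFun hv x
    rw [mulVec_rateMatrix] at hx ⊢
    have hesc : 0 ≤ M.escapeRate α x :=
      Finset.sum_nonneg fun y hy => M.rate_nonneg α x y (Finset.ne_of_mem_erase hy).symm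
    have h1 : M.escapeRate α x * |v x| = |∑ y ∈ Finset.univ.erase x, M.rate α y x * v y| := by
      have : ∑ y ∈ Finset.univ.erase x, M.rate α y x * v y = M.escapeRate α x * v x := by
        simpa [sub_eq_zero] using hx
      rw [this, abs_mul, abs_of_nonneg hesc]
    have h2 : |∑ y ∈ Finset.univ.erase x, M.rate α y x * v y| ≤
        ∑ y ∈ Finset.univ.erase x, M.rate α y x * |v y| := by
      refine (Finset.abs_sum_le_sum_abs _ _).trans (Finset.sum_le_sum fun y hy => ?_)
      rw [abs_mul, abs_of_nonneg (M.rate_nonneg α y x (Finset.ne_of_mem_erase hy))]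
    linarith
  funext x
  exact (Finset.sum_eq_zero_iff_of_nonneg hnn).1 (M.sum_mulVec_rateMatrix α _) x
    (Finset.mem_univ x)

lemma pos_of_mulVec_eq_zero (α : A) (v : S → ℝ) (hv : Matrix.mulVec (M.rateMatrix α) v = 0)
    (hnn : ∀ x, 0 ≤ v x) (x y : S) (hx : 0 < v x) : 0 < v y := by
  have step : ∀ u w, u ≠ w ∧ M.rate α u w ≠ 0 → 0 < v u → 0 < v w := by
    rintro u w ⟨huw, hr⟩ hu
    have hw := congrFun hv w
    rw [mulVec_rateMatrix] at hw
    have hle : M.rate α u w * v u ≤ ∑ z ∈ Finset.univ.erase w, M.rate α z w * v z :=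
      Finset.single_le_sum (f := fun z => M.rate α z w * v z)
        (fun z hz => mul_nonneg (M.rate_nonneg α z w (Finset.ne_of_mem_erase hz)) (hnn z))
        (Finset.mem_erase.2 ⟨huw, Finset.mem_univ u⟩)
    have hpos : 0 < M.rate α u w * v u :=
      mul_pos (lt_of_le_of_ne (M.rate_nonneg α u w huw) hr.symm) hu
    refine lt_of_le_of_ne (hnn w) fun h => ?_
    rw [← h, mul_zero, sub_zero, Pi.zero_apply] at hw
    linarith
  by_cases hxy : x = y
  · exact hxy ▸ hx
  · have h := M.connected α x y hxy
    induction h with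
    | single h => exact step _ _ h hx
    | tail _ h ih =>
      rename_i b c _
      by_cases hb : x = b
      · exact step _ _ h (hb ▸ hx)
      · exact step _ _ h (ih hb)

/-- There is exactly one stationary probability distribution. -/
theorem existsUnique_isStationary [Nonempty S] (α : A) : ∃! p : S → ℝ, M.IsStationary α p := by
  obtain ⟨v, hv0, hv⟩ : ∃ v : S → ℝ, v ≠ 0 ∧ Matrix.mulVec (M.rateMatrix α) v = 0 := by
    rw [Matrix.exists_mulVec_eq_zero_iff, ← Matrix.exists_vecMul_eq_zero_iff]
    refine ⟨fun _ => 1, fun h => ?_, ?_⟩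
    · exact one_ne_zero (congrFun h (Classical.arbitrary S))
    · funext x
      simp [Matrix.vecMul, dotProduct, sum_rateMatrix]
  have habs := M.mulVec_abs α v hv
  have hs : 0 < ∑ x, |v x| := by
    obtain ⟨x, hx⟩ := Function.ne_iff.1 hv0
    exact Finset.sum_pos' (fun _ _ => abs_nonneg _) ⟨x, Finset.mem_univ x, abs_pos.2 hx⟩
  refine ⟨(∑ x, |v x|)⁻¹ • fun x => |v x|, ⟨fun x => ?_, ?_, ?_⟩, ?_⟩
  · simp only [Pi.smul_apply, smul_eq_mul]
    positivity
  · simp only [Pi.smul_apply, smul_eq_mul, ← Finset.mul_sum]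
    exact inv_mul_cancel₀ hs.ne'
  · rw [Matrix.mulVec_smul, habs, smul_zero]
  · suffices key : ∀ p q : S → ℝ, M.IsStationary α p → M.IsStationary α q → p = q by
      intro q hq
      refine key _ _ hq ⟨fun x => ?_, ?_, ?_⟩
      · simp only [Pi.smul_apply, smul_eq_mul]
        positivity
      · simp only [Pi.smul_apply, smul_eq_mul, ← Finset.mul_sum]
        exact inv_mul_cancel₀ hs.ne'
      · rw [Matrix.mulVec_smul, habs, smul_zero]
    rintro p q ⟨_, hp1, hp⟩ ⟨_, hq1, hq⟩
    have hd : Matrix.mulVec (M.rateMatrix α) (p - q) = 0 := by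
      rw [Matrix.mulVec_sub, hp, hq, sub_zero]
    have hda := M.mulVec_abs α _ hd
    have hdsum : ∑ x, (p - q) x = 0 := by
      simp [Finset.sum_sub_distrib, hp1, hq1]
    have hplus : Matrix.mulVec (M.rateMatrix α) ((fun x => |(p - q) x|) + (p - q)) = 0 := by
      rw [Matrix.mulVec_add, hda, hd, add_zero]
    by_contra hne
    obtain ⟨x, hx⟩ := Function.ne_iff.1 (sub_ne_zero.2 hne)
    simp only [Pi.zero_apply] at hx
    have hexpos : ∃ x, 0 < (p - q) x := by
      by_contra! hcon
      have := (Finset.sum_eq_zero_iff_of_nonpos fun x _ => hcon x).1 hdsum x (Finset.mem_univ x)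
      exact hx this
    obtain ⟨x0, hx0⟩ := hexpos
    have hall : ∀ y, 0 < (p - q) y := by
      intro y
      have := M.pos_of_mulVec_eq_zero α _ hplus
        (fun z => by
          have := neg_abs_le ((p - q) z)
          simp only [Pi.add_apply]
          linarith) x0 y
        (by
          have := abs_nonneg ((p - q) x0)
          simp only [Pi.add_apply]
          linarith)
      by_contra hle
      have h2 := abs_of_nonpos (not_lt.1 hle)
      simp only [Pi.add_apply] at this
      linarith
    have : 0 < ∑ y, (p - q) y := Finset.sum_pos (fun y _ => hall y) Finset.univ_nonempty
    linarith

/-- The stationary distribution `ρ^α` (the nonequilibrium steady state). -/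
noncomputable def steadyState [Nonempty S] (α : A) : S → ℝ :=
  (M.existsUnique_isStationary α).choose


/-- The parameters `α` describe an equilibrium system at inverse temperature `β`: the transition
rates satisfy the detailed balance condition with respect to the energy. -/
def IsEquilibrium (α : A) : Prop :=
  ∀ x y, x ≠ y → Real.exp (-M.beta * M.energy (M.nu α) x) * M.rate α x y =
    Real.exp (-M.beta * M.energy (M.nu α) y) * M.rate α y x

/-- The entropy production `θ^α_{x → y}` in the heat baths (used only for transitions with
nonvanishing rate). -/
noncomputable def theta (α : A) (x y : S) : ℝ := Real.log (M.rate α x y / M.rate α y x)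

/-- The nonequilibrium part `ψ^α_{x → y}` of the entropy production. -/
noncomputable def psi (α : A) (x y : S) : ℝ :=
  M.theta α x y - M.beta * (M.energy (M.nu α) x - M.energy (M.nu α) y)

/-- A protocol: a function `t ↦ α(t)`, possibly discontinuous, which is constant before `-τ₀` and
after `τ₀`, and along which the transition rates are measurable and integrable in time. -/
structure Protocol (M : Model S A N) where
  /-- The time scale of the operation. -/
  tau0 : ℝ
  tau0_pos : 0 < tau0
  param : ℝ → A
  param_before : ∀ t, t ≤ -tau0 → param t = param (-tau0)
  param_after : ∀ t, tau0 ≤ t → param t = param tau0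
  measurable_rate : ∀ x y, x ≠ y → Measurable fun t => M.rate (param t) x y
  integrable_rate : ∀ x y, x ≠ y →
    IntervalIntegrable (fun t => M.rate (param t) x y) volume (-tau0) tau0

namespace Protocol

variable {M}

/-- The initial parameters of the protocol. -/
def initial (P : Protocol M) : A := P.param (-P.tau0)

/-- The final parameters of the protocol. -/
def final (P : Protocol M) : A := P.param P.tau0

/-- The time-reversed protocol `t ↦ α(-t)`. -/
def reverse (P : Protocol M) : Protocol M where
  tau0 := P.tau0
  tau0_pos := P.tau0_pos
  param t := P.param (-t)
  param_before t ht := by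
    rw [neg_neg]
    exact P.param_after _ (by linarith)
  param_after t ht := P.param_before _ (by linarith)
  measurable_rate x y h := (P.measurable_rate x y h).comp measurable_neg
  integrable_rate x y h := by
    have := ((P.integrable_rate x y h).comp_sub_left 0).symm
    simpa using this

/-- The weight (transition probability density) of a path on `[-τ, τ]`. -/
noncomputable def weight (P : Protocol M) (τ : ℝ) (ω : JumpPath S) : ℝ :=
  (∏ j : Fin ω.jumps, M.rate (P.param (ω.time j)) (ω.state j.castSucc) (ω.state j.succ)) *
    ∏ j : Fin (ω.jumps + 1), Real.exp
      (-∫ t in (ω.node τ j.castSucc)..(ω.node τ j.succ), M.escapeRate (P.param t) (ω.state j))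

/-- The nonequilibrium part `Ψ` of the total entropy production along a path. -/
noncomputable def entropyNoneq (P : Protocol M) (ω : JumpPath S) : ℝ :=
  ∑ j : Fin ω.jumps, M.psi (P.param (ω.time j)) (ω.state j.castSucc) (ω.state j.succ)

/-- The work `W` done on the system along a path on `[-τ, τ]`. -/
noncomputable def work (P : Protocol M) (τ : ℝ) (ω : JumpPath S) : ℝ :=
  ∑ j : Fin (ω.jumps + 1),
    (M.energy (M.nu (P.param (ω.node τ j.succ))) (ω.state j) -
      M.energy (M.nu (P.param (ω.node τ j.castSucc))) (ω.state j))

/-- The probability density of a path on `[-τ, τ]` for the process that starts at time `-τ` from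
the steady state with parameters `α(-τ)`. -/
noncomputable def steadyDensity [Nonempty S] (P : Protocol M) (τ : ℝ) (ω : JumpPath S) : ℝ :=
  M.steadyState (P.param (-τ)) ω.start * P.weight τ ω

/-- The expectation of `f` over the paths on `[-τ, τ]` that start from the steady state. -/
noncomputable def steadyExp [Nonempty S] (P : Protocol M) (τ : ℝ) (f : JumpPath S → ℝ) : ℝ :=
  pathIntegral τ fun ω => f ω * P.steadyDensity τ ω

/-- The expectation `steadyExp` of `f` converges absolutely. -/
def SteadyIntegrable [Nonempty S] (P : Protocol M) (τ : ℝ) (f : JumpPath S → ℝ) : Prop :=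
  PathIntegrable τ fun ω => f ω * P.steadyDensity τ ω

/-- The path functional `exp[-(β W + Ψ) / 2]`. -/
noncomputable def jarzynskiWeight (P : Protocol M) (τ : ℝ) (ω : JumpPath S) : ℝ :=
  Real.exp (-(M.beta * P.work τ ω + P.entropyNoneq ω) / 2)

end Protocol

end Model

end NESS

/-! The factor exp[-(βW + Ψ)/2] symmetrizes the dynamics. Summation by parts over the jumps turns βW
+ Ψ into the sum of θ over the jumps plus β times the final minus the initial energy, and R e^{-θ/2}
is the geometric mean of a rate and its reverse, symmetric in the two states. Put u_α(x) = ρ^α_x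
e^{βH_x/2} and w_α(x) = e^{-βH_x/2}. The numerator is then the bilinear form ⟨u_α, K w_α'⟩, where K
is the evolution kernel on [-τ, τ] of the symmetric matrices with these geometric means off the
diagonal and -λ on it (`jarzynskiWeight_mul_steadyDensity`, `pathIntegral_of_eq_prod`). Time
reversal transposes K (`kernel_reverse`), so the denominator is ⟨w_α, K u_α'⟩ with the same K.

Before -τ₀ and after τ₀ the generator is a constant irreducible symmetric matrix. Its largest
eigenvalue is simple and has a positive eigenvector φ (`exists_perron_eigenbasis`), and K acts on
eigenvectors by exponentials (`kernel_mul_eigenvector`). Hence e^{-c(τ-τ₀)} K tends to a rank-one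
kernel κ φ_α ⊗ φ_α' with κ > 0 (`tendsto_kernelForm`). In the ratio c and κ cancel, and what remains
is a quotient of a quantity depending on α by the same quantity for α'. This gives F = β⁻¹ log(⟨u,
φ⟩ / ⟨w, φ⟩), in which the scale of φ is immaterial. At equilibrium u = w/Z, so φ drops out and F =
-β⁻¹ log Z.

K is constructed as a Dyson series, a sum over numbers of jumps of integrals over ordered times. The
series is first taken in [0, ∞], where sums and integrals may be exchanged freely; finiteness is
proved afterwards. The diagonal -λ is removed by the gauge factors exp(± integrated escape rate), so
that only nonnegative densities enter. -/

namespace NESS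

/-! ### Integration over ordered jump times -/

open scoped ENNReal

/-- The increasing sequences of `n` times in the interval `(a, b)`. -/
def orderedTimes (a b : ℝ) (n : ℕ) : Set (Fin n → ℝ) :=
  {t | StrictMono t ∧ ∀ j, t j ∈ Set.Ioo a b}

lemma measurableSet_orderedTimes (a b : ℝ) (n : ℕ) : MeasurableSet (orderedTimes a b n) := by
  have : orderedTimes a b n =
      (⋂ i, ⋂ j, {t | i < j → t i < t j}) ∩ ⋂ j, {t | t j ∈ Set.Ioo a b} := by
    ext t
    simp [orderedTimes, StrictMono]
  rw [this]
  refine (MeasurableSet.iInter fun i => MeasurableSet.iInter fun j => ?_).inter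
    (MeasurableSet.iInter fun j => measurableSet_Ioo.preimage (measurable_pi_apply j))
  by_cases h : i < j
  · simpa [h] using measurableSet_lt (measurable_pi_apply i) (measurable_pi_apply j)
  · simp [h]

lemma orderedTimes_mono (a : ℝ) {b c : ℝ} (h : b ≤ c) (n : ℕ) :
    orderedTimes a b n ⊆ orderedTimes a c n :=
  fun _ ht => ⟨ht.1, fun j => ⟨(ht.2 j).1, (ht.2 j).2.trans_le h⟩⟩

lemma orderedTimes_zero (a b : ℝ) : orderedTimes a b 0 = Set.univ := by
  ext t
  simp [orderedTimes, StrictMono]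

lemma snoc_mem_orderedTimes {a b : ℝ} {n : ℕ} (t : Fin n → ℝ) (s : ℝ) :
    (Fin.snoc t s : Fin (n + 1) → ℝ) ∈ orderedTimes a b (n + 1) ↔
      s ∈ Set.Ioo a b ∧ t ∈ orderedTimes a s n := by
  constructor
  · rintro ⟨h1, h2⟩
    have hs := h2 (Fin.last n)
    rw [Fin.snoc_last] at hs
    refine ⟨hs, fun i j hij => ?_, fun j => ⟨?_, ?_⟩⟩
    · have := h1 (Fin.castSucc_lt_castSucc_iff.2 hij)
      simpa only [Fin.snoc_castSucc] using this
    · have := (h2 j.castSucc).1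
      simpa only [Fin.snoc_castSucc] using this
    · have := h1 (Fin.castSucc_lt_last j)
      simpa only [Fin.snoc_castSucc, Fin.snoc_last] using this
  · rintro ⟨hs, h1, h2⟩
    refine ⟨fun i => ?_, fun j => ?_⟩
    · refine Fin.lastCases (fun j hj => absurd hj (not_lt.2 (Fin.le_last j))) (fun i j => ?_) i
      refine Fin.lastCases (fun _ => ?_) (fun j hj => ?_) j
      · simpa only [Fin.snoc_castSucc, Fin.snoc_last] using (h2 i).2
      · simpa only [Fin.snoc_castSucc] using h1 (Fin.castSucc_lt_castSucc_iff.1 hj)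
    · refine Fin.lastCases ?_ (fun j => ?_) j
      · simpa only [Fin.snoc_last] using hs
      · simp only [Fin.snoc_castSucc]
        exact ⟨(h2 j).1, (h2 j).2.trans hs.2⟩

/-- Fubini for the last one of the ordered times. -/
lemma setLIntegral_orderedTimes_succ (a b : ℝ) (n : ℕ) (f : (Fin (n + 1) → ℝ) → ℝ≥0∞)
    (hf : Measurable f) :
    ∫⁻ t in orderedTimes a b (n + 1), f t =
      ∫⁻ s in Set.Ioo a b, ∫⁻ t in orderedTimes a s n, f (Fin.snoc t s) := by
  have hmp := (volume_preserving_piFinSuccAbove (fun _ : Fin (n + 1) => ℝ) (Fin.last n)).symm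
  have hF : Measurable ((orderedTimes a b (n + 1)).indicator f) :=
    hf.indicator (measurableSet_orderedTimes _ _ _)
  rw [← lintegral_indicator (measurableSet_orderedTimes _ _ _), ← hmp.lintegral_comp hF,
    Measure.volume_eq_prod,
    lintegral_prod (fun z => (orderedTimes a b (n + 1)).indicator f
      ((MeasurableEquiv.piFinSuccAbove (fun _ : Fin (n + 1) => ℝ) (Fin.last n)).symm z))
      (hF.comp (MeasurableEquiv.measurable _)).aemeasurable,
    ← lintegral_indicator measurableSet_Ioo]
  refine lintegral_congr fun s => ?_
  have key : ∀ t : Fin n → ℝ,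
      (MeasurableEquiv.piFinSuccAbove (fun _ : Fin (n + 1) => ℝ) (Fin.last n)).symm (s, t) =
        Fin.snoc t s := by
    intro t
    simp [MeasurableEquiv.piFinSuccAbove, Fin.insertNthEquiv]
  simp only [key]
  by_cases hs : s ∈ Set.Ioo a b
  · rw [Set.indicator_of_mem hs, ← lintegral_indicator (measurableSet_orderedTimes _ _ _)]
    refine lintegral_congr fun t => ?_
    by_cases ht : t ∈ orderedTimes a s n
    · rw [Set.indicator_of_mem ((snoc_mem_orderedTimes t s).2 ⟨hs, ht⟩), Set.indicator_of_mem ht]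
    · rw [Set.indicator_of_notMem (fun h => ht ((snoc_mem_orderedTimes t s).1 h).2),
        Set.indicator_of_notMem ht]
  · rw [Set.indicator_of_notMem hs]
    have : ∀ t : Fin n → ℝ,
        (orderedTimes a b (n + 1)).indicator f (Fin.snoc t s : Fin (n + 1) → ℝ) = 0 := fun t =>
      Set.indicator_of_notMem (fun h => hs ((snoc_mem_orderedTimes t s).1 h).1) _
    simp [this]

/-- Ordered times are symmetric under the reversal of time. -/
lemma setLIntegral_orderedTimes_reverse (a b : ℝ) (n : ℕ) (f : (Fin n → ℝ) → ℝ≥0∞)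
    (hf : Measurable f) :
    ∫⁻ t in orderedTimes (-b) (-a) n, f t =
      ∫⁻ t in orderedTimes a b n, f fun i => -t i.rev := by
  have hmp := volume_preserving_arrowCongr' (Fin.revPerm (n := n)) (MeasurableEquiv.neg ℝ)
    (Measure.measurePreserving_neg volume)
  have hF : Measurable ((orderedTimes (-b) (-a) n).indicator f) :=
    hf.indicator (measurableSet_orderedTimes _ _ _)
  rw [← lintegral_indicator (measurableSet_orderedTimes _ _ _), ← hmp.lintegral_comp hF,
    ← lintegral_indicator (measurableSet_orderedTimes _ _ _)]
  refine lintegral_congr fun t => ?_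
  have key : (MeasurableEquiv.arrowCongr' (Fin.revPerm (n := n)) (MeasurableEquiv.neg ℝ)) t =
      fun i => -t i.rev := rfl
  rw [key]
  have hiff : (fun i => -t i.rev) ∈ orderedTimes (-b) (-a) n ↔ t ∈ orderedTimes a b n := by
    constructor
    · rintro ⟨h1, h2⟩
      refine ⟨fun i j hij => ?_, fun j => ?_⟩
      · have := h1 (Fin.rev_lt_rev.2 hij)
        simpa using this
      · have := h2 j.rev
        simp only [Fin.rev_rev, Set.mem_Ioo] at this
        exact ⟨by linarith, by linarith⟩
    · rintro ⟨h1, h2⟩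
      refine ⟨fun i j hij => ?_, fun j => ?_⟩
      · exact neg_lt_neg (h1 (Fin.rev_lt_rev.2 hij))
      · have := h2 j.rev
        exact ⟨neg_lt_neg this.2, neg_lt_neg this.1⟩
  by_cases ht : t ∈ orderedTimes a b n
  · rw [Set.indicator_of_mem (hiff.2 ht), Set.indicator_of_mem ht]
  · rw [Set.indicator_of_notMem (fun h => ht (hiff.1 h)), Set.indicator_of_notMem ht]

/-! ### The Dyson series with values in [0, ∞] -/

section Propagator

variable {S : Type*} (k : S → S → ℝ → ℝ≥0∞)

/-- The iterated integral of the transition densities `k` over the ordered times of the jumps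
between the given states. -/
noncomputable def iteratedIntegral {n : ℕ} (x : Fin (n + 1) → S) (a b : ℝ) : ℝ≥0∞ :=
  ∫⁻ t in orderedTimes a b n, ∏ i, k (x i.castSucc) (x i.succ) (t i)

variable {k}

lemma measurable_prod_density (hk : ∀ x y, Measurable (k x y)) {n : ℕ} (x : Fin (n + 1) → S) :
    Measurable fun t : Fin n → ℝ => ∏ i, k (x i.castSucc) (x i.succ) (t i) :=
  Finset.measurable_prod _ fun i _ => (hk _ _).comp (measurable_pi_apply i)

lemma iteratedIntegral_zero (x : Fin 1 → S) (a b : ℝ) : iteratedIntegral k x a b = 1 := by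
  rw [iteratedIntegral, orderedTimes_zero, Measure.restrict_univ, volume_pi,
    Measure.pi_of_empty (fun _ : Fin 0 => (volume : Measure ℝ)) (fun i => i.elim0)]
  simp

/-- Besides comparing time intervals, this is the source of measurability in the upper endpoint: a
monotone function is measurable. -/
lemma iteratedIntegral_mono {n : ℕ} (x : Fin (n + 1) → S) (a : ℝ) :
    Monotone (iteratedIntegral k x a) :=
  fun _ _ h => lintegral_mono_set (orderedTimes_mono a h n)

lemma iteratedIntegral_snoc (hk : ∀ x y, Measurable (k x y)) {n : ℕ} (x : Fin (n + 1) → S) (y : S)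
    (a b : ℝ) :
    iteratedIntegral k (Fin.snoc x y : Fin (n + 2) → S) a b =
      ∫⁻ s in Set.Ioo a b, iteratedIntegral k x a s * k (x (Fin.last n)) y s := by
  rw [iteratedIntegral, setLIntegral_orderedTimes_succ _ _ _ _ (measurable_prod_density hk _)]
  refine lintegral_congr fun s => ?_
  rw [iteratedIntegral, ← lintegral_mul_const _ (measurable_prod_density hk _)]
  refine lintegral_congr fun t => ?_
  rw [Fin.prod_univ_castSucc]
  simp only [Fin.snoc_castSucc, Fin.snoc_last, Fin.succ_last, ← Fin.castSucc_succ]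

lemma iteratedIntegral_reverse (hk : ∀ x y, Measurable (k x y)) {n : ℕ} (x : Fin (n + 1) → S)
    (a b : ℝ) :
    iteratedIntegral (fun u w t => k w u (-t)) (x ∘ Fin.rev) (-b) (-a) =
      iteratedIntegral k x a b := by
  have hk' : ∀ u w, Measurable fun t => k w u (-t) := fun u w => (hk w u).comp measurable_neg
  rw [iteratedIntegral, setLIntegral_orderedTimes_reverse _ _ _ _
    (measurable_prod_density hk' (x ∘ Fin.rev)), iteratedIntegral]
  refine lintegral_congr fun t => ?_
  refine Fintype.prod_equiv Fin.revPerm _ _ fun i => ?_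
  simp [Fin.rev_castSucc, Fin.rev_succ]

variable [Fintype S] [DecidableEq S] (k)

/-- The contribution to the propagator of the paths with `n` jumps. -/
noncomputable def jumpPropagator (n : ℕ) (a b : ℝ) (u w : S) : ℝ≥0∞ :=
  ∑ x : Fin (n + 1) → S, if x 0 = u ∧ x (Fin.last n) = w then iteratedIntegral k x a b else 0

/-- The propagator of the transition densities `k`: the sum over all the paths from `u` to `w`
on the time interval `(a, b)`. -/
noncomputable def propagator (a b : ℝ) (u w : S) : ℝ≥0∞ := ∑' n, jumpPropagator k n a b u w

variable {k}

lemma sum_iteratedIntegral (n : ℕ) (a b : ℝ) (p q : S → ℝ≥0∞) :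
    ∑ x : Fin (n + 1) → S, p (x 0) * iteratedIntegral k x a b * q (x (Fin.last n)) =
      ∑ u, ∑ w, p u * jumpPropagator k n a b u w * q w := by
  simp only [jumpPropagator, Finset.mul_sum, Finset.sum_mul]
  have : ∀ u : S, ∑ w, ∑ x : Fin (n + 1) → S, p u *
      (if x 0 = u ∧ x (Fin.last n) = w then iteratedIntegral k x a b else 0) * q w =
      ∑ x : Fin (n + 1) → S,
        if x 0 = u then p (x 0) * iteratedIntegral k x a b * q (x (Fin.last n)) else 0 := by
    intro u
    rw [Finset.sum_comm]
    refine Finset.sum_congr rfl fun x _ => ?_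
    by_cases h : x 0 = u
    · simp [h]
    · simp [h]
  rw [Finset.sum_congr rfl fun u _ => this u, Finset.sum_comm]
  simp

lemma jumpPropagator_zero (a b : ℝ) (u w : S) :
    jumpPropagator k 0 a b u w = if u = w then 1 else 0 := by
  rw [jumpPropagator, ← (Equiv.funUnique (Fin 1) S).symm.sum_comp]
  simp only [iteratedIntegral_zero]
  by_cases h : u = w
  · subst h
    simp [Equiv.funUnique]
  · rw [if_neg h]
    refine Finset.sum_eq_zero fun x _ => if_neg ?_
    rintro ⟨rfl, rfl⟩
    exact h rfl

lemma jumpPropagator_mono (n : ℕ) (a : ℝ) (u w : S) :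
    Monotone fun b => jumpPropagator k n a b u w := by
  intro b c h
  refine Finset.sum_le_sum fun x _ => ?_
  split_ifs
  exacts [iteratedIntegral_mono x a h, le_rfl]

/-- Splits off the last jump, at time `s` from `z` to `w`. This recursion yields both the forward
equation and the factorial bound. -/
lemma jumpPropagator_succ (hk : ∀ x y, Measurable (k x y)) (n : ℕ) (a b : ℝ) (u w : S) :
    jumpPropagator k (n + 1) a b u w =
      ∫⁻ s in Set.Ioo a b, ∑ z, jumpPropagator k n a s u z * k z w s := by
  have hm : ∀ (x : Fin (n + 1) → S) , Measurable fun s =>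
      iteratedIntegral k x a s * k (x (Fin.last n)) w s :=
    fun x => (iteratedIntegral_mono x a).measurable.mul (hk _ _)
  rw [jumpPropagator, ← (Fin.snocEquiv fun _ : Fin (n + 2) => S).sum_comp, Fintype.sum_prod_type]
  have h1 : ∀ y : S, ∀ x : Fin (n + 1) → S,
      (Fin.snocEquiv (fun _ : Fin (n + 2) => S)) (y, x) = (Fin.snoc x y : Fin (n + 2) → S) :=
    fun y x => rfl
  have h2 : ∀ y : S, ∀ x : Fin (n + 1) → S, (Fin.snoc x y : Fin (n + 2) → S) 0 = x 0 := by
    intro y x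
    rw [← Fin.castSucc_zero, Fin.snoc_castSucc]
  simp only [h1, h2, Fin.snoc_last, iteratedIntegral_snoc hk]
  rw [Finset.sum_comm]
  have h3 : ∀ s, ∑ z, jumpPropagator k n a s u z * k z w s =
      ∑ x : Fin (n + 1) → S,
        if x 0 = u then iteratedIntegral k x a s * k (x (Fin.last n)) w s else 0 := by
    intro s
    simp only [jumpPropagator, Finset.sum_mul]
    rw [Finset.sum_comm]
    refine Finset.sum_congr rfl fun x _ => ?_
    by_cases h : x 0 = u
    · simp [h]
    · simp [h]
  simp only [h3]
  rw [lintegral_finsetSum]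
  · refine Finset.sum_congr rfl fun x _ => ?_
    by_cases h : x 0 = u
    · simp [h]
    · simp [h]
  · intro x _
    by_cases h : x 0 = u
    · simpa [h] using hm x
    · simp [h]

lemma propagator_mono (a : ℝ) (u w : S) : Monotone fun b => propagator k a b u w :=
  fun _ _ h => ENNReal.tsum_le_tsum fun n => jumpPropagator_mono n a u w h

lemma delta_le_propagator (a b : ℝ) (u w : S) :
    (if u = w then 1 else 0) ≤ propagator k a b u w := by
  rw [← jumpPropagator_zero (k := k) a b]
  exact ENNReal.le_tsum 0

/-- The forward integral equation for the propagator. -/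
lemma propagator_eq (hk : ∀ x y, Measurable (k x y)) (a b : ℝ) (u w : S) :
    propagator k a b u w = (if u = w then 1 else 0) +
      ∫⁻ s in Set.Ioo a b, ∑ z, propagator k a s u z * k z w s := by
  rw [propagator, tsum_eq_zero_add' ENNReal.summable, jumpPropagator_zero]
  congr 1
  simp only [jumpPropagator_succ hk]
  have hm : ∀ n, Measurable fun s => ∑ z, jumpPropagator k n a s u z * k z w s := fun n =>
    Finset.measurable_sum _ fun z _ => (jumpPropagator_mono n a u z).measurable.mul (hk z w)
  rw [← lintegral_tsum fun n => (hm n).aemeasurable]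
  refine lintegral_congr fun s => ?_
  rw [Summable.tsum_finsetSum fun _ _ => ENNReal.summable]
  simp only [ENNReal.tsum_mul_right, propagator]

/-- Running every path backwards is a bijection of the paths with `n` jumps, which exchanges the end
states and preserves the integral over the jump times. -/
lemma propagator_reverse (hk : ∀ x y, Measurable (k x y)) (a b : ℝ) (u w : S) :
    propagator (fun x y t => k y x (-t)) (-b) (-a) w u = propagator k a b u w := by
  refine tsum_congr fun n => ?_
  rw [jumpPropagator, jumpPropagator,
    ← (Equiv.arrowCongr (Fin.revPerm (n := n + 1)) (Equiv.refl S)).sum_comp]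
  refine Finset.sum_congr rfl fun x _ => ?_
  have h1 : (Equiv.arrowCongr (Fin.revPerm (n := n + 1)) (Equiv.refl S)) x = x ∘ Fin.rev := rfl
  rw [h1, iteratedIntegral_reverse hk]
  simp [and_comm]

end Propagator

/-! ### Convergence and the forward equation -/

/-- Transition densities that are nonnegative, measurable, and locally integrable in time. -/
structure IsTransitionDensity {S : Type*} (h : S → S → ℝ → ℝ) : Prop where
  nonneg : ∀ x y t, 0 ≤ h x y t
  measurable : ∀ x y, Measurable (h x y)
  integrable : ∀ x y a b, IntervalIntegrable (h x y) volume a b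

lemma IsTransitionDensity.measurable_ofReal {S : Type*} {h : S → S → ℝ → ℝ}
    (hh : IsTransitionDensity h) (x y : S) : Measurable fun t => ENNReal.ofReal (h x y t) :=
  (hh.measurable x y).ennreal_ofReal

/-- The chain rule for the power of a primitive. Since `G` is only integrable, the primitive is only
absolutely continuous and its derivative exists only almost everywhere. -/
lemma integral_pow_primitive_mul {G : ℝ → ℝ} {a b : ℝ} (hG : IntervalIntegrable G volume a b)
    (n : ℕ) :
    ∫ s in a..b, (∫ r in a..s, G r) ^ n * G s = (∫ r in a..b, G r) ^ (n + 1) / (n + 1) := by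
  set Γ : ℝ → ℝ := fun s => ∫ r in a..s, G r with hΓ
  have hac : AbsolutelyContinuousOnInterval Γ a b :=
    hG.absolutelyContinuousOnInterval_intervalIntegral Set.left_mem_uIcc
  have hpow : ∀ m : ℕ, AbsolutelyContinuousOnInterval (fun s => Γ s ^ (m + 1)) a b := by
    intro m
    induction m with
    | zero => simpa using hac
    | succ m ih =>
      have := ih.fun_mul hac
      simpa only [← pow_succ] using this
  have hd := (hpow n).integral_deriv_eq_sub
  have h0 : Γ a = 0 := by simp [hΓ]
  rw [h0, zero_pow n.succ_ne_zero, sub_zero] at hd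
  rw [eq_div_iff (by positivity), ← hd, ← intervalIntegral.integral_mul_const]
  refine intervalIntegral.integral_congr_ae ?_
  filter_upwards [hG.ae_hasDerivAt_integral] with s hs hmem
  have hs' := (hs (Set.uIoc_subset_uIcc hmem) a Set.left_mem_uIcc).pow (n + 1)
  have h2 : deriv (fun s => Γ s ^ (n + 1)) s = ((n + 1 : ℕ) : ℝ) * Γ s ^ n * G s := hs'.deriv
  rw [h2]
  push_cast
  ring

section Propagator

variable {S : Type*} [Fintype S] [DecidableEq S]

/-- Induction on the number of jumps: the column sums of `k` are at most `G`, and each further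
integration raises the power of the primitive of `G` by one and supplies the next factor of the
factorial. -/
lemma jumpPropagator_le {k : S → S → ℝ → ℝ≥0∞} (hk : ∀ x y, Measurable (k x y)) {G : ℝ → ℝ}
    (hG0 : ∀ s, 0 ≤ G s) (hG : ∀ a b, IntervalIntegrable G volume a b)
    (hkG : ∀ w s, ∑ z, k z w s ≤ ENNReal.ofReal (G s)) (n : ℕ) {a b : ℝ} (hab : a ≤ b) (u w : S) :
    jumpPropagator k n a b u w ≤ ENNReal.ofReal ((∫ s in a..b, G s) ^ n / n.factorial) := by
  induction n generalizing b w with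
  | zero =>
    rw [jumpPropagator_zero]
    split_ifs <;> simp
  | succ n ih =>
    have hΓ0 : ∀ s, a ≤ s → 0 ≤ ∫ r in a..s, G r := fun s hs =>
      intervalIntegral.integral_nonneg hs fun r _ => hG0 r
    have hint : IntervalIntegrable (fun s => (∫ r in a..s, G r) ^ n * G s) volume a b :=
      (hG a b).continuousOn_mul
        ((intervalIntegral.continuous_primitive hG a).pow n).continuousOn
    calc jumpPropagator k (n + 1) a b u w
        = ∫⁻ s in Set.Ioo a b, ∑ z, jumpPropagator k n a s u z * k z w s :=
          jumpPropagator_succ hk n a b u w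
      _ ≤ ∫⁻ s in Set.Ioc a b,
            ENNReal.ofReal ((∫ r in a..s, G r) ^ n * G s / n.factorial) := by
          refine (lintegral_mono_set Set.Ioo_subset_Ioc_self).trans ?_
          refine setLIntegral_mono' measurableSet_Ioc fun s hs => ?_
          calc ∑ z, jumpPropagator k n a s u z * k z w s
              ≤ ∑ z, ENNReal.ofReal ((∫ r in a..s, G r) ^ n / n.factorial) * k z w s :=
                Finset.sum_le_sum fun z _ => mul_le_mul_left (ih hs.1.le z) _
            _ ≤ ENNReal.ofReal ((∫ r in a..s, G r) ^ n / n.factorial) *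
                  ENNReal.ofReal (G s) := by
                rw [← Finset.mul_sum]
                exact mul_le_mul_right (hkG w s) _
            _ = _ := by
                have := hΓ0 s hs.1.le
                rw [← ENNReal.ofReal_mul (by positivity)]
                congr 1
                ring
      _ = ENNReal.ofReal ((∫ s in a..b, G s) ^ (n + 1) / (n + 1).factorial) := by
          rw [← ofReal_integral_eq_lintegral_ofReal]
          · rw [← intervalIntegral.integral_of_le hab, intervalIntegral.integral_div,
              integral_pow_primitive_mul (hG a b), Nat.factorial_succ]
            congr 1
            push_cast
            rw [div_div]
          · exact ((intervalIntegrable_iff_integrableOn_Ioc_of_le hab).1 hint).div_const _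
          · filter_upwards [ae_restrict_mem measurableSet_Ioc] with s hs
            have := hΓ0 s hs.1.le
            have := hG0 s
            positivity

/-- The real-valued propagator of real transition densities. -/
noncomputable def realPropagator (h : S → S → ℝ → ℝ) (a b : ℝ) (u w : S) : ℝ :=
  (propagator (fun x y t => ENNReal.ofReal (h x y t)) a b u w).toReal

namespace IsTransitionDensity

variable {h : S → S → ℝ → ℝ}

lemma propagator_ne_top (hh : IsTransitionDensity h) (a b : ℝ) (u w : S) :
    propagator (fun x y t => ENNReal.ofReal (h x y t)) a b u w ≠ ∞ := by
  -- Monotonicity in the endpoint reduces a general `b` to `max a b`; the bound by a primitive is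
  -- available only for `a ≤ b`.
  suffices H : ∀ b, a ≤ b → propagator (fun x y t => ENNReal.ofReal (h x y t)) a b u w ≠ ∞ from
    ((propagator_mono a u w (le_max_right a b)).trans_lt (H _ (le_max_left a b)).lt_top).ne
  intro b hab
  have hbound := fun n => jumpPropagator_le (k := fun x y t => ENNReal.ofReal (h x y t))
    hh.measurable_ofReal (G := fun s => ∑ z, ∑ w, h z w s)
    (fun s => Finset.sum_nonneg fun z _ => Finset.sum_nonneg fun w _ => hh.nonneg z w s)
    (fun a b => by
      have := IntervalIntegrable.sum (μ := volume) (a := a) (b := b) Finset.univ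
        fun z _ => IntervalIntegrable.sum Finset.univ fun w _ => hh.integrable z w a b
      simpa only [Finset.sum_fn] using this)
    (fun w s => by
      rw [← ENNReal.ofReal_sum_of_nonneg fun z _ => hh.nonneg z w s]
      exact ENNReal.ofReal_le_ofReal (Finset.sum_le_sum fun z _ =>
        Finset.single_le_sum (f := fun w => h z w s) (fun w _ => hh.nonneg z w s)
          (Finset.mem_univ w))) n hab u w
  refine ((ENNReal.tsum_le_tsum hbound).trans_lt ?_).ne
  exact (Real.summable_pow_div_factorial _).tsum_ofReal_lt_top

lemma jumpPropagator_ne_top (hh : IsTransitionDensity h) (n : ℕ) (a b : ℝ) (u w : S) :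
    jumpPropagator (fun x y t => ENNReal.ofReal (h x y t)) n a b u w ≠ ∞ :=
  ((ENNReal.le_tsum n).trans_lt (hh.propagator_ne_top a b u w).lt_top).ne

lemma realPropagator_nonneg (h : S → S → ℝ → ℝ) (a b : ℝ) (u w : S) :
    0 ≤ realPropagator h a b u w := ENNReal.toReal_nonneg

lemma one_le_realPropagator (hh : IsTransitionDensity h) (a b : ℝ) (u : S) :
    1 ≤ realPropagator h a b u u := by
  have := delta_le_propagator (k := fun x y t => ENNReal.ofReal (h x y t)) a b u u
  rw [if_pos rfl] at this
  simpa [realPropagator] using ENNReal.toReal_mono (hh.propagator_ne_top a b u u) this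

lemma realPropagator_reverse (hh : IsTransitionDensity h) (a b : ℝ) (u w : S) :
    realPropagator (fun x y t => h y x (-t)) (-b) (-a) w u = realPropagator h a b u w := by
  rw [realPropagator, realPropagator, ← propagator_reverse hh.measurable_ofReal]

lemma toReal_sum_mul (hh : IsTransitionDensity h) (a s : ℝ) (u w : S) :
    (∑ z, propagator (fun x y t => ENNReal.ofReal (h x y t)) a s u z *
      ENNReal.ofReal (h z w s)).toReal = ∑ z, realPropagator h a s u z * h z w s := by
  rw [ENNReal.toReal_sum fun z _ =>
    ENNReal.mul_ne_top (hh.propagator_ne_top a s u z) ENNReal.ofReal_ne_top]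
  refine Finset.sum_congr rfl fun z _ => ?_
  rw [ENNReal.toReal_mul, ENNReal.toReal_ofReal (hh.nonneg z w s), realPropagator]

lemma measurable_source (hh : IsTransitionDensity h) (a : ℝ) (u w : S) :
    Measurable fun s => ∑ z, propagator (fun x y t => ENNReal.ofReal (h x y t)) a s u z *
      ENNReal.ofReal (h z w s) :=
  Finset.measurable_sum _ fun z _ =>
    (propagator_mono a u z).measurable.mul (hh.measurable_ofReal z w)

/-- By the forward equation the integral of this nonnegative function is at most the propagator,
which is finite. -/
lemma integrableOn_source (hh : IsTransitionDensity h) {a b : ℝ} (u w : S) :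
    IntegrableOn (fun s => ∑ z, realPropagator h a s u z * h z w s) (Set.Ioo a b) := by
  have h1 := propagator_eq hh.measurable_ofReal a b u w
  have h2 : ∫⁻ s in Set.Ioo a b, ∑ z,
      propagator (fun x y t => ENNReal.ofReal (h x y t)) a s u z * ENNReal.ofReal (h z w s) ≠ ∞ :=
    ((h1 ▸ le_add_self).trans_lt (hh.propagator_ne_top a b u w).lt_top).ne
  have := integrable_toReal_of_lintegral_ne_top (hh.measurable_source a u w).aemeasurable h2
  simp only [hh.toReal_sum_mul] at this
  exact this

lemma intervalIntegrable_source (hh : IsTransitionDensity h) {a b c : ℝ} (hab : a ≤ b)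
    (hac : a ≤ c) (u w : S) :
    IntervalIntegrable (fun s => ∑ z, realPropagator h a s u z * h z w s) volume b c := by
  have H : ∀ {c}, a ≤ c →
      IntervalIntegrable (fun s => ∑ z, realPropagator h a s u z * h z w s) volume a c :=
    fun {c} hc => (intervalIntegrable_iff_integrableOn_Ioo_of_le hc).2
      (hh.integrableOn_source u w)
  exact (H hab).symm.trans (H hac)

/-- The forward integral equation for the real-valued propagator. -/
lemma realPropagator_eq (hh : IsTransitionDensity h) {a b : ℝ} (hab : a ≤ b) (u w : S) :
    realPropagator h a b u w = (if u = w then 1 else 0) +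
      ∫ s in a..b, ∑ z, realPropagator h a s u z * h z w s := by
  have h1 := propagator_eq hh.measurable_ofReal a b u w
  have h2 : ∫⁻ s in Set.Ioo a b, ∑ z,
      propagator (fun x y t => ENNReal.ofReal (h x y t)) a s u z * ENNReal.ofReal (h z w s) ≠ ∞ :=
    ((h1 ▸ le_add_self).trans_lt (hh.propagator_ne_top a b u w).lt_top).ne
  have h3 := integral_toReal (hh.measurable_source a u w).aemeasurable
    (μ := volume.restrict (Set.Ioo a b))
    (ae_of_all _ fun s => ENNReal.sum_lt_top.2 fun z _ =>
      ENNReal.mul_lt_top (hh.propagator_ne_top a s u z).lt_top ENNReal.ofReal_lt_top)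
  simp only [hh.toReal_sum_mul] at h3
  rw [intervalIntegral.integral_of_le hab, integral_Ioc_eq_integral_Ioo, h3, realPropagator, h1,
    ENNReal.toReal_add (by split_ifs <;> simp) h2]
  congr 1
  split_ifs <;> simp

lemma realPropagator_eq_add (hh : IsTransitionDensity h) {a b c : ℝ} (hab : a ≤ b)
    (hac : a ≤ c) (u w : S) :
    realPropagator h a c u w = realPropagator h a b u w +
      ∫ s in b..c, ∑ z, realPropagator h a s u z * h z w s := by
  rw [hh.realPropagator_eq hab, hh.realPropagator_eq hac, add_assoc,
    intervalIntegral.integral_add_adjacent_intervals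
      (hh.intervalIntegrable_source le_rfl hab u w) (hh.intervalIntegrable_source hab hac u w)]

lemma continuousAt_realPropagator (hh : IsTransitionDensity h) {a t : ℝ} (hat : a < t) (u w : S) :
    ContinuousAt (fun t => realPropagator h a t u w) t := by
  have hc : ContinuousOn (fun t => (if u = w then 1 else 0) +
      ∫ s in a..t, ∑ z, realPropagator h a s u z * h z w s) (Set.Icc a (t + 1)) := by
    refine continuousOn_const.add ?_
    have := intervalIntegral.continuousOn_primitive_interval
      (f := fun s => ∑ z, realPropagator h a s u z * h z w s) (μ := volume) (a := a) (b := t + 1)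
      ((intervalIntegrable_iff' (by simp)).1
        (hh.intervalIntegrable_source le_rfl (by linarith) u w))
    rwa [Set.uIcc_of_le (by linarith)] at this
  have hn : Set.Icc a (t + 1) ∈ 𝓝 t := Icc_mem_nhds hat (by linarith)
  refine (hc.continuousAt hn).congr ?_
  filter_upwards [hn] with s hs
  exact (hh.realPropagator_eq hs.1 u w).symm

/-- Where the transition densities agree to the right with continuous functions, the propagator
is differentiable from the right. -/
lemma hasDerivWithinAt_realPropagator (hh : IsTransitionDensity h) {a c t : ℝ} (hac : a < c)
    (hct : c ≤ t) (u w : S)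
    (f : S → ℝ → ℝ) (hf : ∀ z, Continuous (f z)) (hhf : ∀ z s, c ≤ s → h z w s = f z s) :
    HasDerivWithinAt (fun t => realPropagator h a t u w)
      (∑ z, realPropagator h a t u z * h z w t) (Set.Ici t) t := by
  have hU : ∀ z, Monotone fun s => realPropagator h a s u z := fun z s s' hs =>
    ENNReal.toReal_mono (hh.propagator_ne_top a s' u z) (propagator_mono a u z hs)
  -- With `f` in place of `h` the integrand is continuous at `t` from both sides, even at `t = c`,
  -- so the two-sided fundamental theorem applies; the two integrands agree to the right of `t`.
  have hcont : ContinuousAt (fun s => ∑ z, realPropagator h a s u z * f z s) t :=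
    tendsto_finsetSum _ fun z _ =>
      (hh.continuousAt_realPropagator (hac.trans_le hct) u z).mul (hf z).continuousAt
  have hmeas : Measurable (fun s => ∑ z, realPropagator h a s u z * f z s) :=
    Finset.measurable_sum _ fun z _ => (hU z).measurable.mul (hf z).measurable
  have hd := intervalIntegral.integral_hasDerivAt_right
    (f := fun s => ∑ z, realPropagator h a s u z * f z s) (a := t) (b := t) (by simp)
    hmeas.stronglyMeasurable.stronglyMeasurableAtFilter hcont
  have hd2 := (hd.const_add (realPropagator h a t u w)).hasDerivWithinAt (s := Set.Ici t)
  simp only [hhf _ t hct]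
  have heq : ∀ s ∈ Set.Ici t, realPropagator h a s u w = realPropagator h a t u w +
      ∫ r in t..s, ∑ z, realPropagator h a r u z * f z r := by
    intro s hs
    have hts : t ≤ s := hs
    rw [hh.realPropagator_eq_add (b := t) (c := s) (by linarith) (by linarith)]
    congr 1
    refine intervalIntegral.integral_congr fun r hr => ?_
    rw [Set.uIcc_of_le hts] at hr
    exact Finset.sum_congr rfl fun z _ => by rw [hhf z r (hct.trans hr.1)]
  exact hd2.congr heq (heq t Set.self_mem_Ici)

end IsTransitionDensity

end Propagator

/-! ### Perron's theorem for symmetric matrices -/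

section Perron

open Matrix

variable {S : Type*} [Fintype S] [DecidableEq S] {A : Matrix S S ℝ}

/-- If `w u = 0`, row `u` of the eigenvalue equation is a vanishing sum of nonnegative terms, so `w`
vanishes wherever `u` leads in one step. Positivity thus propagates backwards along the connecting
chains. -/
lemma pos_of_mulVec_eq_smul (hoff : ∀ x y, x ≠ y → 0 ≤ A x y)
    (hconn : ∀ x y, x ≠ y → Relation.TransGen (fun u v => u ≠ v ∧ A u v ≠ 0) x y)
    {μ : ℝ} {w : S → ℝ} (hw : A *ᵥ w = μ • w) (hnn : ∀ x, 0 ≤ w x) (hne : w ≠ 0) (x : S) :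
    0 < w x := by
  obtain ⟨y, hy⟩ := Function.ne_iff.1 hne
  have hypos : 0 < w y := lt_of_le_of_ne (hnn y) (Ne.symm hy)
  have step : ∀ u v, u ≠ v ∧ A u v ≠ 0 → 0 < w v → 0 < w u := by
    rintro u v ⟨huv, hA⟩ hv
    refine lt_of_le_of_ne (hnn u) fun h => ?_
    have hu := congrFun hw u
    rw [Pi.smul_apply, ← h, smul_zero, mulVec, dotProduct] at hu
    have hle : A u v * w v ≤ ∑ z, A u z * w z := by
      refine Finset.single_le_sum (f := fun z => A u z * w z) (fun z _ => ?_) (Finset.mem_univ v)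
      by_cases hz : u = z
      · simp [← hz, ← h]
      · exact mul_nonneg (hoff u z hz) (hnn z)
    have : 0 < A u v * w v := mul_pos (lt_of_le_of_ne (hoff u v huv) hA.symm) hv
    linarith
  by_cases hxy : x = y
  · exact hxy ▸ hypos
  · have h := hconn x y hxy
    induction h using Relation.TransGen.head_induction_on with
    | single h => exact step _ _ h hypos
    | head h _ ih =>
      rename_i a c _
      by_cases hc : c = y
      · exact step _ _ h (hc ▸ hypos)
      · exact step _ _ h (ih hc)

/-- Perron's theorem for an irreducible symmetric matrix with nonnegative off-diagonal entries:
there is an orthonormal basis of eigenvectors in which the largest eigenvalue is simple and has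
a positive eigenvector. -/
theorem exists_perron_eigenbasis [Nonempty S] (hA : A.IsHermitian)
    (hoff : ∀ x y, x ≠ y → 0 ≤ A x y)
    (hconn : ∀ x y, x ≠ y → Relation.TransGen (fun u v => u ≠ v ∧ A u v ≠ 0) x y) :
    ∃ (μ : S → ℝ) (v : S → S → ℝ) (i₀ : S), (∀ i, A *ᵥ v i = μ i • v i) ∧
      (∀ x y, ∑ i, v i x * v i y = if x = y then 1 else 0) ∧
      (∀ i, i ≠ i₀ → μ i < μ i₀) ∧ ∀ x, 0 < v i₀ x := by
  set μ := hA.eigenvalues with hμ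
  set v : S → S → ℝ := fun i => ⇑(hA.eigenvectorBasis i) with hvdef
  have hv : ∀ i, A *ᵥ v i = μ i • v i := hA.mulVec_eigenvectorBasis
  have horth : ∀ i j, v i ⬝ᵥ v j = if i = j then 1 else 0 := by
    intro i j
    rw [← orthonormal_iff_ite.1 hA.eigenvectorBasis.orthonormal i j,
      EuclideanSpace.inner_eq_star_dotProduct, dotProduct_comm]
    simp [hvdef]
  have hcomp : ∀ x y, ∑ i, v i x * v i y = if x = y then 1 else 0 := by
    have h1 : Matrix.of v * (Matrix.of v)ᵀ = 1 := by
      ext i j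
      simpa [Matrix.mul_apply, dotProduct, Matrix.one_apply] using horth i j
    have h2 := mul_eq_one_comm.1 h1
    intro x y
    simpa [Matrix.mul_apply, Matrix.one_apply] using congrFun (congrFun h2 x) y
  have hsymm : ∀ x y, A x y = A y x := fun x y => by simpa using hA.apply y x
  have hpars : ∀ w z : S → ℝ, w ⬝ᵥ z = ∑ i, (v i ⬝ᵥ w) * (v i ⬝ᵥ z) := by
    intro w z
    have : ∀ i, (v i ⬝ᵥ w) * (v i ⬝ᵥ z) = ∑ x, ∑ y, v i x * v i y * (w x * z y) := by
      intro i
      rw [dotProduct, dotProduct, Finset.sum_mul_sum]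
      refine Finset.sum_congr rfl fun x _ => Finset.sum_congr rfl fun y _ => ?_
      ring
    simp only [this]
    rw [Finset.sum_comm]
    refine Finset.sum_congr rfl fun x _ => ?_
    rw [Finset.sum_comm]
    simp [← Finset.sum_mul, hcomp]
  obtain ⟨i₀, hi₀⟩ := Finite.exists_max μ
  -- A vector attaining the maximal Rayleigh quotient is an eigenvector: in the eigenbasis the
  -- defect `d` has coefficients `(μ i₀ - μ i) (v i ⬝ᵥ w)`, and `w ⬝ᵥ d ≤ 0` is a sum of nonnegative
  -- terms, so all of them vanish.
  have hquad : ∀ w : S → ℝ, μ i₀ * (w ⬝ᵥ w) ≤ w ⬝ᵥ (A *ᵥ w) → A *ᵥ w = μ i₀ • w := by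
    intro w hw
    set d := μ i₀ • w - A *ᵥ w with hd
    have hvd : ∀ i, v i ⬝ᵥ d = (μ i₀ - μ i) * (v i ⬝ᵥ w) := by
      intro i
      have h1 : v i ⬝ᵥ (A *ᵥ w) = μ i * (v i ⬝ᵥ w) := by
        have ht : Aᵀ = A := by ext x y; exact hsymm y x
        rw [dotProduct_mulVec, ← mulVec_transpose, ht, hv, smul_dotProduct, smul_eq_mul]
      rw [hd, dotProduct_sub, dotProduct_smul, h1, smul_eq_mul]
      ring
    have hnn : ∀ i ∈ Finset.univ, 0 ≤ (v i ⬝ᵥ w) * (v i ⬝ᵥ d) := by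
      intro i _
      rw [hvd]
      have := hi₀ i
      nlinarith [mul_nonneg (sub_nonneg.2 this) (mul_self_nonneg (v i ⬝ᵥ w))]
    have hwd : w ⬝ᵥ d ≤ 0 := by
      rw [hd, dotProduct_sub, dotProduct_smul, smul_eq_mul]
      linarith
    rw [hpars] at hwd
    have hz := (Finset.sum_eq_zero_iff_of_nonneg hnn).1
      (le_antisymm hwd (Finset.sum_nonneg hnn))
    have hzero : d ⬝ᵥ d = 0 := by
      rw [hpars]
      refine Finset.sum_eq_zero fun i hi => ?_
      have := hz i hi
      rcases mul_eq_zero.1 this with h | h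
      · rw [hvd, h]
        simp
      · simp [h]
    have hd0 : d = 0 := dotProduct_self_eq_zero.1 hzero
    rw [hd, sub_eq_zero] at hd0
    exact hd0.symm
  -- Taking absolute values keeps the norm and, as off-diagonal entries are nonnegative, does not
  -- lower the quadratic form.
  have habs : ∀ u : S → ℝ, A *ᵥ u = μ i₀ • u →
      A *ᵥ (fun x => |u x|) = μ i₀ • fun x => |u x| := by
    intro u hu
    refine hquad _ ?_
    have h1 : (fun x => |u x|) ⬝ᵥ (fun x => |u x|) = u ⬝ᵥ u := by
      simp [dotProduct]
    have h2 : u ⬝ᵥ (A *ᵥ u) = μ i₀ * (u ⬝ᵥ u) := by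
      rw [hu, dotProduct_smul, smul_eq_mul]
    rw [h1, ← h2]
    simp only [dotProduct, mulVec, Finset.mul_sum]
    refine Finset.sum_le_sum fun x _ => Finset.sum_le_sum fun y _ => ?_
    by_cases hxy : x = y
    · subst hxy
      have := abs_mul_abs_self (u x)
      linear_combination -A x x * this
    · have := le_abs_self (u x * u y)
      rw [abs_mul] at this
      nlinarith [mul_le_mul_of_nonneg_left this (hoff x y hxy)]
  have hnz : ∀ u : S → ℝ, A *ᵥ u = μ i₀ • u → u ≠ 0 → ∀ x, u x ≠ 0 := by
    intro u hu hne x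
    have := pos_of_mulVec_eq_smul hoff hconn (habs u hu) (fun y => abs_nonneg _) (fun h => hne (by
      funext y
      simpa using congrFun h y)) x
    simpa using this
  -- Simplicity of the top eigenvalue: this combination vanishes at `x`, whereas nonzero top
  -- eigenvectors have no zero entry.
  have hprop : ∀ u w : S → ℝ, A *ᵥ u = μ i₀ • u → A *ᵥ w = μ i₀ • w → ∀ x,
      w x • u = u x • w := by
    intro u w hu hw x
    by_contra hne
    have h1 : A *ᵥ (w x • u - u x • w) = μ i₀ • (w x • u - u x • w) := by
      rw [mulVec_sub, mulVec_smul, mulVec_smul, hu, hw, smul_sub, smul_comm, smul_comm (u x)]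
    refine hnz _ h1 (sub_ne_zero.2 hne) x ?_
    simp [mul_comm]
  have hv0 : ∀ i, v i ≠ 0 := by
    intro i h
    have := horth i i
    rw [h] at this
    simp at this
  obtain ⟨x₀⟩ := ‹Nonempty S›
  have hc0 := hnz _ (hv i₀) (hv0 i₀) x₀
  obtain ⟨ε, hε, hεv⟩ : ∃ ε : ℝ, ε * ε = 1 ∧ ∀ x, ε * v i₀ x = |v i₀ x| := by
    have h := hprop _ _ (hv i₀) (habs _ (hv i₀)) x₀
    refine ⟨|v i₀ x₀| / v i₀ x₀, ?_, fun x => ?_⟩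
    · rw [div_mul_div_comm, abs_mul_abs_self, div_self (mul_ne_zero hc0 hc0)]
    · have := congrFun h x
      simp only [Pi.smul_apply, smul_eq_mul] at this
      field_simp
      linarith
  -- One common sign `ε` makes the top eigenvector positive; since `ε * ε = 1`, the completeness
  -- relation is unaffected.
  refine ⟨μ, fun i => ε • v i, i₀, fun i => ?_, fun x y => ?_, fun i hi => ?_, fun x => ?_⟩
  · rw [mulVec_smul, hv, smul_comm]
  · rw [← hcomp]
    refine Finset.sum_congr rfl fun i _ => ?_
    simp only [Pi.smul_apply, smul_eq_mul]
    linear_combination (v i x * v i y) * hε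
  · refine lt_of_le_of_ne (hi₀ i) fun h => ?_
    have h1 := hprop _ _ (hv i₀) (by rw [hv i, h] : A *ᵥ v i = μ i₀ • v i) x₀
    have h2 := congrArg (fun z => z ⬝ᵥ v i) h1
    simp only [smul_dotProduct, horth, if_neg hi.symm] at h2
    simp at h2
    exact hc0 h2.symm
  · simp only [Pi.smul_apply, smul_eq_mul, hεv]
    exact abs_pos.2 (hnz _ (hv i₀) (hv0 i₀) x)

end Perron

/-! ### Path integrals as propagators -/

section PathIntegral

lemma iteratedIntegral_eq_zero {S : Type*} [Fintype S] {k : S → S → ℝ → ℝ≥0∞}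
    (hdiag : ∀ u t, k u u t = 0) {n : ℕ} {x : Fin (n + 1) → S} (hx : x ∉ jumpStates S n) (a b : ℝ) :
    iteratedIntegral k x a b = 0 := by
  simp only [jumpStates, Finset.mem_filter, Finset.mem_univ, true_and, not_forall,
    not_not] at hx
  obtain ⟨j, hj⟩ := hx
  have : ∀ t : Fin n → ℝ, ∏ i, k (x i.castSucc) (x i.succ) (t i) = 0 := fun t =>
    Finset.prod_eq_zero (Finset.mem_univ j) (by rw [hj, hdiag])
  simp [iteratedIntegral, this]

variable {S : Type*} [Fintype S] [DecidableEq S]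

lemma iteratedIntegral_ne_top {h : S → S → ℝ → ℝ} (hh : IsTransitionDensity h) {n : ℕ}
    (x : Fin (n + 1) → S) (a b : ℝ) :
    iteratedIntegral (fun u w t => ENNReal.ofReal (h u w t)) x a b ≠ ∞ := by
  refine ne_top_of_le_ne_top (hh.jumpPropagator_ne_top n a b (x 0) (x (Fin.last n))) ?_
  rw [jumpPropagator]
  refine le_trans ?_ (Finset.single_le_sum (f := fun y : Fin (n + 1) → S =>
    if y 0 = x 0 ∧ y (Fin.last n) = x (Fin.last n) then
      iteratedIntegral (fun u w t => ENNReal.ofReal (h u w t)) y a b else 0)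
    (fun _ _ => zero_le) (Finset.mem_univ x))
  simp

/-- The integral over all paths of a product of transition densities and of functions of the
initial and final states. -/
lemma pathIntegral_of_eq_prod {h : S → S → ℝ → ℝ} (hh : IsTransitionDensity h)
    (hdiag : ∀ u t, h u u t = 0) {p q : S → ℝ} (hp : ∀ u, 0 ≤ p u) (hq : ∀ u, 0 ≤ q u) (τ : ℝ)
    (f : JumpPath S → ℝ)
    (hf : ∀ n : ℕ, ∀ x ∈ jumpStates S n, ∀ t : Fin n → ℝ, f ⟨n, x, t⟩ =
      p (x 0) * (∏ i, h (x i.castSucc) (x i.succ) (t i)) * q (x (Fin.last n))) :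
    PathIntegrable τ f ∧
      pathIntegral τ f = ∑ u, ∑ w, p u * realPropagator h (-τ) τ u w * q w := by
  set k : S → S → ℝ → ℝ≥0∞ := fun u w t => ENNReal.ofReal (h u w t) with hk
  have hnn : ∀ n : ℕ, ∀ x ∈ jumpStates S n, ∀ t : Fin n → ℝ, 0 ≤ f ⟨n, x, t⟩ := by
    intro n x hx t
    rw [hf n x hx]
    exact mul_nonneg (mul_nonneg (hp _) (Finset.prod_nonneg fun i _ => hh.nonneg _ _ _)) (hq _)
  have hmeas : ∀ n : ℕ, ∀ x ∈ jumpStates S n, Measurable fun t => f ⟨n, x, t⟩ := by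
    intro n x hx
    simp only [hf n x hx]
    exact ((Finset.measurable_prod _ fun i _ =>
      (hh.measurable _ _).comp (measurable_pi_apply i)).const_mul _).mul_const _
  have hlint : ∀ n : ℕ, ∀ x ∈ jumpStates S n,
      ∫⁻ t in jumpTimes τ n, ENNReal.ofReal (f ⟨n, x, t⟩) =
        ENNReal.ofReal (p (x 0)) * iteratedIntegral k x (-τ) τ *
          ENNReal.ofReal (q (x (Fin.last n))) := by
    intro n x hx
    have hm := measurable_prod_density (k := k) hh.measurable_ofReal x
    rw [iteratedIntegral, ← lintegral_const_mul _ hm,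
      ← lintegral_mul_const _ (hm.const_mul _)]
    refine lintegral_congr fun t => ?_
    rw [hf n x hx, ENNReal.ofReal_mul (mul_nonneg (hp _)
      (Finset.prod_nonneg fun i _ => hh.nonneg _ _ _)), ENNReal.ofReal_mul (hp _),
      ENNReal.ofReal_prod_of_nonneg fun i _ => hh.nonneg _ _ _]
  have hint : ∀ n : ℕ, ∀ x ∈ jumpStates S n,
      ∫ t in jumpTimes τ n, f ⟨n, x, t⟩ =
        (ENNReal.ofReal (p (x 0)) * iteratedIntegral k x (-τ) τ *
          ENNReal.ofReal (q (x (Fin.last n)))).toReal := by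
    intro n x hx
    rw [integral_eq_lintegral_of_nonneg_ae (ae_of_all _ (hnn n x hx))
      (hmeas n x hx).aestronglyMeasurable, hlint n x hx]
  have hfin : ∀ n : ℕ, ∀ x : Fin (n + 1) → S,
      ENNReal.ofReal (p (x 0)) * iteratedIntegral k x (-τ) τ *
          ENNReal.ofReal (q (x (Fin.last n))) ≠ ∞ := fun n x =>
    ENNReal.mul_ne_top (ENNReal.mul_ne_top ENNReal.ofReal_ne_top
      (iteratedIntegral_ne_top hh x _ _)) ENNReal.ofReal_ne_top
  have hsum : ∀ n : ℕ, ∑ x ∈ jumpStates S n, ∫ t in jumpTimes τ n, f ⟨n, x, t⟩ =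
      ∑ u, ∑ w, p u * (jumpPropagator k n (-τ) τ u w).toReal * q w := by
    intro n
    rw [Finset.sum_congr rfl (hint n), ← ENNReal.toReal_sum fun x _ => hfin n x,
      -- Sequences with a repeated consecutive state contribute nothing because the densities vanish
      -- on the diagonal, so the sum may run over all sequences.
      Finset.sum_subset (Finset.subset_univ _) (fun x _ hx => by
        rw [iteratedIntegral_eq_zero (k := k) (fun u t => by simp [hk, hdiag]) hx]
        simp),
      sum_iteratedIntegral n (-τ) τ (fun u => ENNReal.ofReal (p u)) fun u => ENNReal.ofReal (q u)]
    have hfin' : ∀ u w, ENNReal.ofReal (p u) * jumpPropagator k n (-τ) τ u w *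
        ENNReal.ofReal (q w) ≠ ∞ := fun u w =>
      ENNReal.mul_ne_top (ENNReal.mul_ne_top ENNReal.ofReal_ne_top
        (hh.jumpPropagator_ne_top n _ _ u w)) ENNReal.ofReal_ne_top
    rw [ENNReal.toReal_sum fun u _ => ENNReal.sum_ne_top.2 fun w _ => hfin' u w]
    refine Finset.sum_congr rfl fun u _ => ?_
    rw [ENNReal.toReal_sum fun w _ => hfin' u w]
    refine Finset.sum_congr rfl fun w _ => ?_
    rw [ENNReal.toReal_mul, ENNReal.toReal_mul, ENNReal.toReal_ofReal (hp u),
      ENNReal.toReal_ofReal (hq w)]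
  have hhas : HasSum (fun n : ℕ => ∑ x ∈ jumpStates S n, ∫ t in jumpTimes τ n, f ⟨n, x, t⟩)
      (∑ u, ∑ w, p u * realPropagator h (-τ) τ u w * q w) := by
    simp only [hsum]
    refine hasSum_sum fun u _ => hasSum_sum fun w _ => HasSum.mul_right _ (HasSum.mul_left _ ?_)
    have hne := hh.propagator_ne_top (-τ) τ u w
    rw [realPropagator, propagator,
      ENNReal.tsum_toReal_eq fun n => hh.jumpPropagator_ne_top n _ _ u w]
    exact (ENNReal.summable_toReal hne).hasSum
  refine ⟨⟨fun n x hx => ⟨(hmeas n x hx).aestronglyMeasurable, ?_⟩, ?_⟩, hhas.tsum_eq⟩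
  · rw [hasFiniteIntegral_iff_ofReal (ae_of_all _ (hnn n x hx)), hlint n x hx]
    exact (hfin n x).lt_top
  · refine hhas.summable.congr fun n => Finset.sum_congr rfl fun x hx => ?_
    refine integral_congr_ae (ae_of_all _ fun t => ?_)
    exact (abs_of_nonneg (hnn n x hx t)).symm

end PathIntegral

/-- Summation by parts over the nodes of a path. -/
lemma sum_node_sub {S : Type*} (τ : ℝ) (ω : JumpPath S) (f : S → ℝ → ℝ) :
    ∑ j : Fin (ω.jumps + 1),
      (f (ω.state j) (ω.node τ j.succ) - f (ω.state j) (ω.node τ j.castSucc)) =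
    f (ω.state (Fin.last _)) τ - f (ω.state 0) (-τ) +
      ∑ i : Fin ω.jumps,
        (f (ω.state i.castSucc) (ω.time i) - f (ω.state i.succ) (ω.time i)) := by
  rw [Finset.sum_sub_distrib, Finset.sum_sub_distrib, Fin.sum_univ_castSucc, Fin.sum_univ_succ
    (fun j : Fin (ω.jumps + 1) => f (ω.state j) (ω.node τ j.castSucc))]
  have h1 : ω.node τ (Fin.last ω.jumps).succ = τ := by
    simp only [JumpPath.node, Fin.cons_succ, Fin.snoc_last]
  have h2 : ω.node τ (0 : Fin (ω.jumps + 1)).castSucc = -τ := by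
    simp only [JumpPath.node, Fin.castSucc_zero, Fin.cons_zero]
  have h3 : ∀ i : Fin ω.jumps, ω.node τ i.castSucc.succ = ω.time i := by
    intro i
    simp only [JumpPath.node, Fin.cons_succ, Fin.snoc_castSucc]
  have h4 : ∀ i : Fin ω.jumps, ω.node τ i.succ.castSucc = ω.time i := by
    intro i
    rw [← Fin.succ_castSucc, h3]
  simp only [h1, h2, h3, h4]
  ring

/-! ### Symmetrized rates -/

namespace Model

section Rates

variable {S A N : Type*} [DecidableEq S] (M : Model S A N)

/-- The geometric mean of the rates of a transition and of its reverse. -/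
noncomputable def symRate (α : A) (x y : S) : ℝ :=
  if x = y then 0 else √(M.rate α x y * M.rate α y x)

lemma symRate_comm (α : A) (x y : S) : M.symRate α x y = M.symRate α y x := by
  simp only [symRate, eq_comm (a := x), mul_comm (M.rate α x y)]

lemma symRate_nonneg (α : A) (x y : S) : 0 ≤ M.symRate α x y := by
  rw [symRate]
  split_ifs
  exacts [le_rfl, Real.sqrt_nonneg _]

lemma rate_mul_exp_theta (α : A) {x y : S} (hxy : x ≠ y) :
    M.rate α x y * Real.exp (-M.theta α x y / 2) = M.symRate α x y := by
  rw [symRate, if_neg hxy]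
  by_cases h : M.rate α x y = 0
  -- Here `theta` is a default value of the logarithm, but both sides vanish.
  · simp [h]
  · have h1 : 0 < M.rate α x y := lt_of_le_of_ne (M.rate_nonneg α x y hxy) (Ne.symm h)
    have h2 : 0 < M.rate α y x :=
      lt_of_le_of_ne (M.rate_nonneg α y x hxy.symm) (M.rate_rev α x y hxy h).symm
    have h3 : Real.exp (-M.theta α x y / 2) ^ 2 = M.rate α y x / M.rate α x y := by
      rw [← Real.exp_nat_mul, theta]
      have : ((2 : ℕ) : ℝ) * (-Real.log (M.rate α x y / M.rate α y x) / 2) =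
          -Real.log (M.rate α x y / M.rate α y x) := by push_cast; ring
      rw [this, Real.exp_neg, Real.exp_log (div_pos h1 h2), inv_div]
    symm
    rw [Real.sqrt_eq_iff_mul_self_eq (by positivity) (by positivity)]
    have : M.rate α x y * Real.exp (-M.theta α x y / 2) *
        (M.rate α x y * Real.exp (-M.theta α x y / 2)) =
        M.rate α x y ^ 2 * Real.exp (-M.theta α x y / 2) ^ 2 := by ring
    rw [this, h3]
    field_simp

end Rates

namespace Protocol

variable {S A N : Type*} {M : Model S A N} (P : Protocol M)

lemma param_of_le {t : ℝ} (ht : t ≤ -P.tau0) : P.param t = P.initial := P.param_before t ht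

lemma param_of_ge {t : ℝ} (ht : P.tau0 ≤ t) : P.param t = P.final := P.param_after t ht

lemma reverse_final : P.reverse.final = P.initial := rfl

lemma reverse_initial : P.reverse.initial = P.final := by
  simp [initial, final, reverse]

lemma intervalIntegrable_rate {x y : S} (hxy : x ≠ y) (a b : ℝ) :
    IntervalIntegrable (fun t => M.rate (P.param t) x y) volume a b := by
  have hright : ∀ b, P.tau0 ≤ b →
      IntervalIntegrable (fun t => M.rate (P.param t) x y) volume P.tau0 b := by
    intro b hb
    refine (intervalIntegrable_const (c := M.rate P.final x y)).congr fun t ht => ?_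
    rw [Set.uIoc_of_le hb] at ht
    simp only [P.param_of_ge ht.1.le]
  have hleft : ∀ a, a ≤ -P.tau0 →
      IntervalIntegrable (fun t => M.rate (P.param t) x y) volume a (-P.tau0) := by
    intro a ha
    refine (intervalIntegrable_const (c := M.rate P.initial x y)).congr fun t ht => ?_
    rw [Set.uIoc_of_le ha] at ht
    simp only [P.param_of_le ht.2]
  have hlarge : ∀ R, P.tau0 ≤ R →
      IntervalIntegrable (fun t => M.rate (P.param t) x y) volume (-R) R := fun R hR =>
    ((hleft (-R) (by linarith)).trans (P.integrable_rate x y hxy)).trans (hright R hR)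
  refine (hlarge (max P.tau0 (max |a| |b|)) (le_max_left _ _)).mono_set ?_
  have h1 : |a| ≤ max P.tau0 (max |a| |b|) := (le_max_left _ _).trans (le_max_right _ _)
  have h2 : |b| ≤ max P.tau0 (max |a| |b|) := (le_max_right _ _).trans (le_max_right _ _)
  refine Set.uIcc_subset_uIcc ?_ ?_ <;>
    rw [Set.uIcc_of_le (by linarith [abs_nonneg a])]
  exacts [abs_le.1 h1, abs_le.1 h2]

end Protocol

variable {S A N : Type*} [Fintype S] [DecidableEq S] (M : Model S A N)

/-- The symmetrization of the transition rate matrix. -/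
noncomputable def symMatrix (α : A) : Matrix S S ℝ :=
  Matrix.of fun x y => if x = y then -M.escapeRate α x else M.symRate α x y

lemma isHermitian_symMatrix (α : A) : (M.symMatrix α).IsHermitian := by
  ext x y
  simp only [symMatrix, Matrix.conjTranspose_apply, Matrix.of_apply, star_trivial]
  by_cases h : x = y
  · simp [h]
  · rw [if_neg h, if_neg (Ne.symm h), M.symRate_comm]

/-- An eigenvector basis of the symmetrized rate matrix with a positive eigenvector for the
largest eigenvalue, which is simple. -/
lemma exists_eigenbasis_symMatrix [Nonempty S] (α : A) :
    ∃ (μ : S → ℝ) (v : S → S → ℝ) (i₀ : S),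
      (∀ i, Matrix.mulVec (M.symMatrix α) (v i) = μ i • v i) ∧
      (∀ x y, ∑ i, v i x * v i y = if x = y then 1 else 0) ∧
      (∀ i, i ≠ i₀ → μ i < μ i₀) ∧ ∀ x, 0 < v i₀ x := by
  refine exists_perron_eigenbasis (M.isHermitian_symMatrix α) (fun x y h => ?_) fun x y h => ?_
  · simpa [symMatrix, h] using M.symRate_nonneg α x y
  · refine Relation.TransGen.mono (fun u v huv => ⟨huv.1, ?_⟩) x y (M.connected α x y h)
    have h1 := lt_of_le_of_ne (M.rate_nonneg α u v huv.1) huv.2.symm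
    have h2 := lt_of_le_of_ne (M.rate_nonneg α v u huv.1.symm)
      (M.rate_rev α u v huv.1 huv.2).symm
    simpa [symMatrix, huv.1, symRate] using (Real.sqrt_pos.2 (mul_pos h1 h2)).ne'

/-! ### The symmetrized kernel of a protocol -/

namespace Protocol

variable {M} (P : Protocol M)

lemma intervalIntegrable_escapeRate (x : S) (a b : ℝ) :
    IntervalIntegrable (fun t => M.escapeRate (P.param t) x) volume a b := by
  have := IntervalIntegrable.sum (μ := volume) (a := a) (b := b) (Finset.univ.erase x)
    (f := fun y t => M.rate (P.param t) x y)
    fun y hy => P.intervalIntegrable_rate (Finset.ne_of_mem_erase hy).symm a b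
  simp only [Finset.sum_fn] at this
  exact this

/-- The escape rate of the state `x`, integrated over time. -/
noncomputable def cumEscape (x : S) (t : ℝ) : ℝ := ∫ s in (0 : ℝ)..t, M.escapeRate (P.param s) x

lemma integral_escapeRate (x : S) (a b : ℝ) :
    ∫ s in a..b, M.escapeRate (P.param s) x = P.cumEscape x b - P.cumEscape x a :=
  (intervalIntegral.integral_interval_sub_left (P.intervalIntegrable_escapeRate x 0 b)
    (P.intervalIntegrable_escapeRate x 0 a)).symm

lemma continuous_cumEscape (x : S) : Continuous (P.cumEscape x) :=
  intervalIntegral.continuous_primitive (P.intervalIntegrable_escapeRate x) 0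

lemma cumEscape_of_ge (x : S) {t : ℝ} (ht : P.tau0 ≤ t) :
    P.cumEscape x t = P.cumEscape x P.tau0 + M.escapeRate P.final x * (t - P.tau0) := by
  have h := P.integral_escapeRate x P.tau0 t
  have h2 : ∫ s in P.tau0..t, M.escapeRate (P.param s) x =
      ∫ _ in P.tau0..t, M.escapeRate P.final x := by
    refine intervalIntegral.integral_congr fun s hs => ?_
    rw [Set.uIcc_of_le ht] at hs
    simp only [P.param_of_ge hs.1]
  rw [h2, intervalIntegral.integral_const, smul_eq_mul] at h
  linarith

lemma cumEscape_reverse (x : S) (t : ℝ) : P.reverse.cumEscape x t = -P.cumEscape x (-t) := by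
  have := intervalIntegral.integral_comp_neg (a := 0) (b := t)
    fun s => M.escapeRate (P.param s) x
  rw [neg_zero] at this
  rw [cumEscape, cumEscape, ← intervalIntegral.integral_symm, ← this]
  rfl

/-- The symmetrized transition rates along the protocol, in the gauge in which the survival
probabilities are absorbed. -/
noncomputable def density (x y : S) (t : ℝ) : ℝ :=
  M.symRate (P.param t) x y * Real.exp (P.cumEscape y t - P.cumEscape x t)

lemma density_self (x : S) (t : ℝ) : P.density x x t = 0 := by
  simp [density, symRate]

lemma density_reverse : P.reverse.density = fun x y t => P.density y x (-t) := by
  funext x y t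
  rw [density, density, cumEscape_reverse, cumEscape_reverse, M.symRate_comm]
  congr 2
  ring

lemma isTransitionDensity : IsTransitionDensity P.density where
  nonneg x y t := mul_nonneg (M.symRate_nonneg _ x y) (Real.exp_nonneg _)
  measurable x y := by
    refine Measurable.mul ?_ ((P.continuous_cumEscape y).sub
      (P.continuous_cumEscape x)).rexp.measurable
    by_cases h : x = y
    · simp [symRate, h]
    · simp only [symRate, if_neg h]
      exact ((P.measurable_rate x y h).mul (P.measurable_rate y x (Ne.symm h))).sqrt
  integrable x y a b := by
    refine IntervalIntegrable.mul_continuousOn ?_ ((P.continuous_cumEscape y).sub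
      (P.continuous_cumEscape x)).rexp.continuousOn
    by_cases h : x = y
    · simp [symRate, h]
    · simp only [symRate, if_neg h]
      -- The geometric mean of two rates is dominated by their sum.
      refine ((P.intervalIntegrable_rate h a b).add
        (P.intervalIntegrable_rate (Ne.symm h) a b)).mono_fun'
        ((P.measurable_rate x y h).mul
          (P.measurable_rate y x (Ne.symm h))).sqrt.aestronglyMeasurable
        (ae_of_all _ fun t => ?_)
      have h1 := M.rate_nonneg (P.param t) x y h
      have h2 := M.rate_nonneg (P.param t) y x (Ne.symm h)
      change ‖√_‖ ≤ _
      rw [Real.norm_of_nonneg (Real.sqrt_nonneg _)]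
      refine Real.sqrt_le_iff.2 ⟨add_nonneg h1 h2, ?_⟩
      nlinarith [mul_nonneg h1 h2]

/-- The total symmetrized weight of the paths from `u` to `w` on the time interval `[a, b]`. -/
noncomputable def kernel (a b : ℝ) (u w : S) : ℝ :=
  Real.exp (P.cumEscape u a) * realPropagator P.density a b u w * Real.exp (-P.cumEscape w b)

lemma kernel_nonneg (a b : ℝ) (u w : S) : 0 ≤ P.kernel a b u w :=
  mul_nonneg (mul_nonneg (Real.exp_nonneg _)
    (IsTransitionDensity.realPropagator_nonneg _ _ _ _ _)) (Real.exp_nonneg _)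

lemma kernel_self_pos (a b : ℝ) (u : S) : 0 < P.kernel a b u u :=
  mul_pos (mul_pos (Real.exp_pos _)
    (one_pos.trans_le (P.isTransitionDensity.one_le_realPropagator a b u))) (Real.exp_pos _)

lemma kernel_reverse (a b : ℝ) (u w : S) : P.reverse.kernel (-b) (-a) w u = P.kernel a b u w := by
  rw [kernel, kernel, density_reverse, P.isTransitionDensity.realPropagator_reverse,
    cumEscape_reverse, cumEscape_reverse, neg_neg, neg_neg, neg_neg]
  ring

/-- The path without jumps already makes the diagonal of the kernel positive, so irreducibility
plays no role here. -/
lemma sum_kernel_pos {p q : S → ℝ} (hp : ∀ u, 0 < p u) (hq : ∀ u, 0 < q u) [Nonempty S]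
    (a b : ℝ) : 0 < ∑ u, ∑ w, p u * P.kernel a b u w * q w := by
  have hnn : ∀ u w, 0 ≤ p u * P.kernel a b u w * q w := fun u w =>
    mul_nonneg (mul_nonneg (hp u).le (P.kernel_nonneg a b u w)) (hq w).le
  refine Finset.sum_pos (fun u _ => ?_) Finset.univ_nonempty
  exact Finset.sum_pos' (fun w _ => hnn u w)
    ⟨u, Finset.mem_univ u, mul_pos (mul_pos (hp u) (P.kernel_self_pos a b u)) (hq u)⟩

/-- After the operation the kernel acts on an eigenvector of the final symmetrized rate matrix by
an exponential of time. -/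
lemma kernel_mul_eigenvector {v : S → ℝ} {μ : ℝ}
    (hv : Matrix.mulVec (M.symMatrix P.final) v = μ • v) {a t : ℝ} (ha : a ≤ -P.tau0)
    (ht : P.tau0 ≤ t) (u : S) :
    ∑ w, P.kernel a t u w * v w =
      Real.exp (μ * (t - P.tau0)) * ∑ w, P.kernel a P.tau0 u w * v w := by
  have hτ := P.tau0_pos
  have hd := P.isTransitionDensity
  -- Derivatives are taken from the right only, because the rates may jump at `P.tau0`.
  have hE : ∀ w t, P.tau0 ≤ t → HasDerivWithinAt (fun t => Real.exp (-P.cumEscape w t))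
      (-M.escapeRate P.final w * Real.exp (-P.cumEscape w t)) (Set.Ici t) t := by
    intro w t ht
    have h1 : HasDerivAt (fun t => P.cumEscape w P.tau0 +
        M.escapeRate P.final w * (t - P.tau0)) (M.escapeRate P.final w) t := by
      simpa using (((hasDerivAt_id t).sub_const P.tau0).const_mul
        (M.escapeRate P.final w)).const_add (P.cumEscape w P.tau0)
    have h2 : HasDerivWithinAt (P.cumEscape w) (M.escapeRate P.final w) (Set.Ici t) t :=
      h1.hasDerivWithinAt.congr (fun s hs => P.cumEscape_of_ge w (ht.trans hs))
        (P.cumEscape_of_ge w ht)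
    refine h2.neg.exp.congr_deriv ?_
    simp only [Pi.neg_apply]
    ring
  have hU : ∀ w t, P.tau0 ≤ t → HasDerivWithinAt (fun t => realPropagator P.density a t u w)
      (∑ z, realPropagator P.density a t u z * P.density z w t) (Set.Ici t) t := by
    intro w t ht
    refine hd.hasDerivWithinAt_realPropagator (c := P.tau0) (by linarith) ht u w
      (fun z s => M.symRate P.final z w * Real.exp (P.cumEscape w s - P.cumEscape z s))
      (fun z => continuous_const.mul
        ((P.continuous_cumEscape w).sub (P.continuous_cumEscape z)).rexp) fun z s hs => ?_
    rw [density, P.param_of_ge hs]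
  -- The forward equation K' = K A for the final symmetrized matrix A: differentiating the gauge
  -- factor gives the diagonal of A, differentiating the propagator gives the rest.
  have hK : ∀ w t, P.tau0 ≤ t → HasDerivWithinAt (fun t => P.kernel a t u w)
      (∑ z, P.kernel a t u z * M.symMatrix P.final z w) (Set.Ici t) t := by
    intro w t ht
    refine (((hU w t ht).const_mul (Real.exp (P.cumEscape u a))).mul (hE w t ht)).congr_deriv ?_
    rw [← Finset.add_sum_erase _ (fun z => P.kernel a t u z * M.symMatrix P.final z w)
      (Finset.mem_univ w), ← Finset.add_sum_erase _
      (fun z => realPropagator P.density a t u z * P.density z w t) (Finset.mem_univ w),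
      density_self, mul_zero, zero_add, add_comm]
    congr 1
    · simp only [symMatrix, Matrix.of_apply, if_true, kernel]
      ring
    · rw [Finset.mul_sum, Finset.sum_mul]
      refine Finset.sum_congr rfl fun z hz => ?_
      simp only [symMatrix, Matrix.of_apply, if_neg (Finset.ne_of_mem_erase hz), kernel, density,
        P.param_of_ge ht]
      have : Real.exp (-P.cumEscape z t) =
          Real.exp (P.cumEscape w t - P.cumEscape z t) * Real.exp (-P.cumEscape w t) := by
        rw [← Real.exp_add]
        congr 1
        ring
      rw [this]
      ring
  have hy : ∀ t, P.tau0 ≤ t → HasDerivWithinAt (fun t => ∑ w, P.kernel a t u w * v w)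
      (μ * ∑ w, P.kernel a t u w * v w) (Set.Ici t) t := by
    intro t ht
    refine (HasDerivWithinAt.fun_sum fun w _ => (hK w t ht).mul_const (v w)).congr_deriv ?_
    simp only [Finset.sum_mul, Finset.mul_sum]
    rw [Finset.sum_comm]
    refine Finset.sum_congr rfl fun z _ => ?_
    have := congrFun hv z
    simp only [Matrix.mulVec, dotProduct, Pi.smul_apply, smul_eq_mul] at this
    simp only [mul_assoc, ← Finset.mul_sum, this]
    ring
  have hcont : ∀ t, P.tau0 ≤ t → ContinuousAt (fun t => ∑ w, P.kernel a t u w * v w) t := by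
    intro t ht
    refine tendsto_finsetSum _ fun w _ => Tendsto.mul_const _ ?_
    exact (continuousAt_const.mul (hd.continuousAt_realPropagator (by linarith) u w)).mul
      (P.continuous_cumEscape w).neg.rexp.continuousAt
  -- The function y = K v satisfies y' = μ y, so y multiplied by the inverse exponential is
  -- constant.
  have hconst := constant_of_has_deriv_right_zero
    (f := fun s => Real.exp (-(μ * (s - P.tau0))) * ∑ w, P.kernel a s u w * v w)
    (a := P.tau0) (b := t)
    (fun s hs => ((by fun_prop :
      Continuous fun s => Real.exp (-(μ * (s - P.tau0)))).continuousAt.mul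
        (hcont s hs.1)).continuousWithinAt)
    (fun s hs => by
      have he : HasDerivAt (fun s => Real.exp (-(μ * (s - P.tau0))))
          (Real.exp (-(μ * (s - P.tau0))) * -μ) s := by
        have := (((hasDerivAt_id s).sub_const P.tau0).const_mul μ).neg.exp
        simpa using this
      refine (he.hasDerivWithinAt.mul (hy s hs.1)).congr_deriv ?_
      ring) t ⟨ht, le_rfl⟩
  simp only [sub_self, mul_zero, neg_zero, Real.exp_zero, one_mul] at hconst
  rw [← hconst, ← mul_assoc, ← Real.exp_add]
  simp

end Protocol

end Model

/-! ### Boundary factors and the free energy -/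

namespace Model

section FinalFactor

variable {S A N : Type*} (M : Model S A N)

/-- The factor of the final state in the expectation over paths. -/
noncomputable def finalFactor (α : A) (x : S) : ℝ :=
  Real.exp (-(M.beta * M.energy (M.nu α) x / 2))

lemma finalFactor_pos (α : A) (x : S) : 0 < M.finalFactor α x := Real.exp_pos _

end FinalFactor

variable {S A N : Type*} [Fintype S] [DecidableEq S] (M : Model S A N)

section SteadyState

variable [Nonempty S]

lemma isStationary_steadyState (α : A) : M.IsStationary α (M.steadyState α) :=
  (M.existsUnique_isStationary α).choose_spec.1

lemma steadyState_pos (α : A) (x : S) : 0 < M.steadyState α x := by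
  obtain ⟨h1, h2, h3⟩ := M.isStationary_steadyState α
  obtain ⟨y, hy⟩ : ∃ y, 0 < M.steadyState α y := by
    by_contra! hcon
    have : ∑ x, M.steadyState α x ≤ 0 := Finset.sum_nonpos fun x _ => hcon x
    linarith
  exact M.pos_of_mulVec_eq_zero α _ h3 h1 y x hy

/-- Detailed balance makes the Gibbs distribution stationary, and the stationary distribution is
unique. -/
lemma steadyState_of_isEquilibrium {α : A} (hα : M.IsEquilibrium α) (x : S) :
    M.steadyState α x = Real.exp (-M.beta * M.energy (M.nu α) x) /
      ∑ y, Real.exp (-M.beta * M.energy (M.nu α) y) := by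
  set Z := ∑ y, Real.exp (-M.beta * M.energy (M.nu α) y) with hZ
  have hZpos : 0 < Z := Finset.sum_pos (fun y _ => Real.exp_pos _) Finset.univ_nonempty
  have hstat : M.IsStationary α fun x => Real.exp (-M.beta * M.energy (M.nu α) x) / Z := by
    refine ⟨fun x => by positivity, ?_, ?_⟩
    · rw [← Finset.sum_div, ← hZ, div_self hZpos.ne']
    · funext x
      rw [mulVec_rateMatrix, escapeRate, Finset.sum_mul, Pi.zero_apply, sub_eq_zero]
      refine Finset.sum_congr rfl fun y hy => ?_
      have := hα x y (Finset.ne_of_mem_erase hy).symm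
      rw [← mul_div_assoc, ← mul_div_assoc, mul_comm, ← this, mul_comm]
  exact congrFun ((M.existsUnique_isStationary α).unique (M.isStationary_steadyState α) hstat) x

/-- A positive eigenvector of the symmetrized rate matrix for its largest eigenvalue. -/
noncomputable def perronVector (α : A) : S → ℝ :=
  (M.exists_eigenbasis_symMatrix α).choose_spec.choose
    (M.exists_eigenbasis_symMatrix α).choose_spec.choose_spec.choose

lemma perronVector_pos (α : A) (x : S) : 0 < M.perronVector α x :=
  (M.exists_eigenbasis_symMatrix α).choose_spec.choose_spec.choose_spec.2.2.2 x

/-- Ties the vector chosen in `perronVector` to a full eigenbasis, so that spectral expansions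
single out exactly that vector. -/
lemma exists_eigenbasis_perronVector (α : A) :
    ∃ (μ : S → ℝ) (v : S → S → ℝ) (i₀ : S),
      (∀ i, Matrix.mulVec (M.symMatrix α) (v i) = μ i • v i) ∧
      (∀ x y, ∑ i, v i x * v i y = if x = y then 1 else 0) ∧
      (∀ i, i ≠ i₀ → μ i < μ i₀) ∧ v i₀ = M.perronVector α :=
  have h := (M.exists_eigenbasis_symMatrix α).choose_spec.choose_spec.choose_spec
  ⟨_, _, _, h.1, h.2.1, h.2.2.1, rfl⟩

/-- The factor of the initial state in the expectation over paths from the steady state. -/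
noncomputable def initialFactor (α : A) (x : S) : ℝ :=
  M.steadyState α x * Real.exp (M.beta * M.energy (M.nu α) x / 2)

lemma initialFactor_pos (α : A) (x : S) : 0 < M.initialFactor α x :=
  mul_pos (M.steadyState_pos α x) (Real.exp_pos _)

/-- The nonequilibrium free energy. -/
noncomputable def freeEnergy (α : A) : ℝ :=
  1 / M.beta * Real.log ((∑ x, M.initialFactor α x * M.perronVector α x) /
    ∑ x, M.finalFactor α x * M.perronVector α x)

/-- At equilibrium the initial factor is Z⁻¹ times the final factor, so the Perron vector drops out
of the quotient. -/
lemma freeEnergy_of_isEquilibrium {α : A} (hα : M.IsEquilibrium α) :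
    M.freeEnergy α = -(1 / M.beta) *
      Real.log (∑ x : S, Real.exp (-M.beta * M.energy (M.nu α) x)) := by
  set Z := ∑ y, Real.exp (-M.beta * M.energy (M.nu α) y) with hZ
  have h1 : ∀ x, M.initialFactor α x = Z⁻¹ * M.finalFactor α x := by
    intro x
    have : Real.exp (-M.beta * M.energy (M.nu α) x) =
        Real.exp (-(M.beta * M.energy (M.nu α) x / 2)) *
          Real.exp (-(M.beta * M.energy (M.nu α) x / 2)) := by
      rw [← Real.exp_add]
      congr 1
      ring
    have hinv : Real.exp (-(M.beta * M.energy (M.nu α) x / 2)) *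
        Real.exp (M.beta * M.energy (M.nu α) x / 2) = 1 := by
      rw [← Real.exp_add, neg_add_cancel, Real.exp_zero]
    rw [initialFactor, finalFactor, M.steadyState_of_isEquilibrium hα, ← hZ, this]
    linear_combination Z⁻¹ * Real.exp (-(M.beta * M.energy (M.nu α) x / 2)) * hinv
  have h2 : 0 < ∑ x, M.finalFactor α x * M.perronVector α x :=
    Finset.sum_pos (fun x _ => mul_pos (M.finalFactor_pos α x) (M.perronVector_pos α x))
      Finset.univ_nonempty
  rw [freeEnergy]
  simp only [h1, mul_assoc, ← Finset.mul_sum]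
  rw [mul_div_assoc, div_self h2.ne', mul_one, Real.log_inv]
  ring

end SteadyState

/-! ### Long-time factorization and evaluation of the expectations -/

namespace Protocol

variable {M} (P : Protocol M)

/-- The bilinear form of the kernel over the time interval `[-τ, τ]`. -/
noncomputable def kernelForm (τ : ℝ) (p q : S → ℝ) : ℝ :=
  ∑ u, ∑ w, p u * P.kernel (-τ) τ u w * q w

lemma kernelForm_reverse (τ : ℝ) (p q : S → ℝ) :
    P.reverse.kernelForm τ p q = P.kernelForm τ q p := by
  rw [kernelForm, Finset.sum_comm]
  refine Finset.sum_congr rfl fun u _ => Finset.sum_congr rfl fun w _ => ?_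
  have := P.kernel_reverse (-τ) τ u w
  rw [neg_neg] at this
  rw [this]
  ring

/-- The mirror image of `kernel_mul_eigenvector`, obtained from the reversed protocol, whose final
parameters are the initial ones. -/
lemma kernel_eigenvector_mul {v : S → ℝ} {μ : ℝ}
    (hv : Matrix.mulVec (M.symMatrix P.initial) v = μ • v) {τ : ℝ} (hτ : P.tau0 ≤ τ) (w : S) :
    ∑ u, v u * P.kernel (-τ) P.tau0 u w =
      Real.exp (μ * (τ - P.tau0)) * ∑ u, v u * P.kernel (-P.tau0) P.tau0 u w := by
  have h := P.reverse.kernel_mul_eigenvector hv (a := -P.tau0) le_rfl hτ w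
  have h1 : ∀ s u, P.reverse.kernel (-P.tau0) s w u = P.kernel (-s) P.tau0 u w := by
    intro s u
    have := P.kernel_reverse (-s) P.tau0 u w
    rwa [neg_neg] at this
  simp only [h1, mul_comm _ (v _)] at h
  exact h

/-- Each end of the time interval is moved in to the operation separately: the late end contributes
`μ'`, the early end `μ`. -/
lemma kernelForm_eigenvectors {v v' : S → ℝ} {μ μ' : ℝ}
    (hv : Matrix.mulVec (M.symMatrix P.initial) v = μ • v)
    (hv' : Matrix.mulVec (M.symMatrix P.final) v' = μ' • v') {τ : ℝ} (hτ : P.tau0 ≤ τ) :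
    P.kernelForm τ v v' = Real.exp ((μ + μ') * (τ - P.tau0)) * P.kernelForm P.tau0 v v' := by
  have h1 : ∀ τ', P.kernelForm τ' v v' = ∑ u, v u * ∑ w, P.kernel (-τ') τ' u w * v' w := by
    intro τ'
    simp only [kernelForm, Finset.mul_sum, mul_assoc]
  have h2 : ∀ u, ∑ w, P.kernel (-τ) τ u w * v' w =
      Real.exp (μ' * (τ - P.tau0)) * ∑ w, P.kernel (-τ) P.tau0 u w * v' w := fun u =>
    P.kernel_mul_eigenvector hv' (by linarith) hτ u
  have h3 : ∀ τ', ∑ u, v u * ∑ w, P.kernel (-τ') P.tau0 u w * v' w =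
      ∑ w, (∑ u, v u * P.kernel (-τ') P.tau0 u w) * v' w := by
    intro τ'
    simp only [Finset.mul_sum, Finset.sum_mul]
    rw [Finset.sum_comm]
    simp only [mul_assoc]
  rw [h1, h1, h3 P.tau0]
  simp only [h2, mul_left_comm (v _)]
  rw [← Finset.mul_sum, h3]
  simp only [P.kernel_eigenvector_mul hv hτ, mul_assoc]
  rw [← Finset.mul_sum, add_mul, Real.exp_add]
  ring

lemma kernelForm_expand {v v' : S → S → ℝ}
    (hv : ∀ x y, ∑ i, v i x * v i y = if x = y then 1 else 0)
    (hv' : ∀ x y, ∑ i, v' i x * v' i y = if x = y then 1 else 0) (τ : ℝ) (p q : S → ℝ) :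
    P.kernelForm τ p q =
      ∑ i, ∑ j, (∑ x, p x * v i x) * P.kernelForm τ (v i) (v' j) * ∑ x, q x * v' j x := by
  have hexp : ∀ (v : S → S → ℝ), (∀ x y, ∑ i, v i x * v i y = if x = y then 1 else 0) →
      ∀ (p : S → ℝ) (u : S), p u = ∑ i, (∑ x, p x * v i x) * v i u := by
    intro v hv p u
    simp only [Finset.sum_mul, mul_assoc]
    rw [Finset.sum_comm]
    simp [← Finset.mul_sum, hv]
  have hleft : ∀ p q : S → ℝ, P.kernelForm τ p q =
      ∑ i, (∑ x, p x * v i x) * P.kernelForm τ (v i) q := by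
    intro p q
    simp only [kernelForm, Finset.mul_sum]
    symm
    rw [Finset.sum_comm]
    refine Finset.sum_congr rfl fun u _ => ?_
    rw [Finset.sum_comm]
    refine Finset.sum_congr rfl fun w _ => ?_
    conv_rhs => rw [hexp v hv p u]
    rw [Finset.sum_mul, Finset.sum_mul]
    exact Finset.sum_congr rfl fun i _ => by ring
  have hright : ∀ p q : S → ℝ, P.kernelForm τ p q =
      ∑ j, P.kernelForm τ p (v' j) * ∑ x, q x * v' j x := by
    intro p q
    simp only [kernelForm, Finset.sum_mul]
    symm
    rw [Finset.sum_comm]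
    refine Finset.sum_congr rfl fun u _ => ?_
    rw [Finset.sum_comm]
    refine Finset.sum_congr rfl fun w _ => ?_
    conv_rhs => rw [hexp v' hv' q w]
    rw [Finset.mul_sum]
    exact Finset.sum_congr rfl fun i _ => by ring
  rw [hleft]
  refine Finset.sum_congr rfl fun i _ => ?_
  rw [hright, Finset.mul_sum]
  exact Finset.sum_congr rfl fun j _ => by ring

/-- For long times the kernel form factorizes. -/
lemma tendsto_kernelForm [Nonempty S] :
    ∃ c κ : ℝ, 0 < κ ∧ ∀ p q : S → ℝ,
      Tendsto (fun τ => Real.exp (-(c * (τ - P.tau0))) * P.kernelForm τ p q) atTop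
        (𝓝 ((∑ x, p x * M.perronVector P.initial x) * κ *
          ∑ x, q x * M.perronVector P.final x)) := by
  obtain ⟨μ, v, i₀, hv, hcomp, hlt, hφ⟩ := M.exists_eigenbasis_perronVector P.initial
  obtain ⟨μ', v', j₀, hv', hcomp', hlt', hφ'⟩ := M.exists_eigenbasis_perronVector P.final
  -- Neither constant depends on `p` and `q`, which is what lets both cancel in the ratio of
  -- expectations.
  refine ⟨μ i₀ + μ' j₀, P.kernelForm P.tau0 (M.perronVector P.initial) (M.perronVector P.final),
    P.sum_kernel_pos (M.perronVector_pos _) (M.perronVector_pos _) _ _, fun p q => ?_⟩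
  rw [← hφ, ← hφ']
  have hterm : ∀ i j, Tendsto (fun τ => Real.exp (-((μ i₀ + μ' j₀) * (τ - P.tau0))) *
      Real.exp ((μ i + μ' j) * (τ - P.tau0))) atTop
      (𝓝 (if i = i₀ ∧ j = j₀ then 1 else 0)) := by
    intro i j
    have hc : ∀ τ, Real.exp (-((μ i₀ + μ' j₀) * (τ - P.tau0))) *
        Real.exp ((μ i + μ' j) * (τ - P.tau0)) =
        Real.exp (((μ i - μ i₀) + (μ' j - μ' j₀)) * (τ - P.tau0)) := by
      intro τ
      rw [← Real.exp_add]
      congr 1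
      ring
    simp only [hc]
    by_cases hij : i = i₀ ∧ j = j₀
    · rw [if_pos hij, hij.1, hij.2]
      simp
    · rw [if_neg hij]
      have h1 : μ i - μ i₀ ≤ 0 := by
        by_cases h : i = i₀
        -- Both differences are nonpositive; below, at least one is strict by the spectral gap.
        · simp [h]
        · linarith [hlt i h]
      have h2 : μ' j - μ' j₀ ≤ 0 := by
        by_cases h : j = j₀
        · simp [h]
        · linarith [hlt' j h]
      have hneg : (μ i - μ i₀) + (μ' j - μ' j₀) < 0 := by
        by_cases h : i = i₀
        · linarith [hlt' j fun h' => hij ⟨h, h'⟩]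
        · linarith [hlt i h]
      refine Real.tendsto_exp_atBot.comp ?_
      exact (tendsto_atTop_add_const_right _ _ tendsto_id).const_mul_atTop_of_neg hneg
  have hlim : Tendsto (fun τ => ∑ i, ∑ j, (Real.exp (-((μ i₀ + μ' j₀) * (τ - P.tau0))) *
      Real.exp ((μ i + μ' j) * (τ - P.tau0))) * ((∑ x, p x * v i x) *
        P.kernelForm P.tau0 (v i) (v' j) * ∑ x, q x * v' j x)) atTop
      (𝓝 (∑ i, ∑ j, (if i = i₀ ∧ j = j₀ then 1 else 0) * ((∑ x, p x * v i x) *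
        P.kernelForm P.tau0 (v i) (v' j) * ∑ x, q x * v' j x))) :=
    tendsto_finsetSum _ fun i _ => tendsto_finsetSum _ fun j _ => (hterm i j).mul_const _
  have hval : ∑ i, ∑ j, (if i = i₀ ∧ j = j₀ then (1 : ℝ) else 0) * ((∑ x, p x * v i x) *
        P.kernelForm P.tau0 (v i) (v' j) * ∑ x, q x * v' j x) =
      (∑ x, p x * v i₀ x) * P.kernelForm P.tau0 (v i₀) (v' j₀) * ∑ x, q x * v' j₀ x := by
    rw [Finset.sum_eq_single i₀, Finset.sum_eq_single j₀]
    · simp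
    · intro j _ hj
      simp [hj]
    · simp
    · intro i _ hi
      simp [hi]
    · simp
  rw [hval] at hlim
  refine hlim.congr' ?_
  filter_upwards [eventually_ge_atTop P.tau0] with τ hτ
  rw [P.kernelForm_expand hcomp hcomp', Finset.mul_sum]
  refine Finset.sum_congr rfl fun i _ => ?_
  rw [Finset.mul_sum]
  refine Finset.sum_congr rfl fun j _ => ?_
  rw [P.kernelForm_eigenvectors (hv i) (hv' j) hτ]
  ring

/-- The expectation integrand in terms of the symmetrized rates: the energies cancel except at
the ends of the path. -/
lemma jarzynskiWeight_mul_steadyDensity [Nonempty S] {τ : ℝ} (hτ : P.tau0 ≤ τ) {n : ℕ}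
    {x : Fin (n + 1) → S} (hx : x ∈ jumpStates S n) (t : Fin n → ℝ) :
    P.jarzynskiWeight τ ⟨n, x, t⟩ * P.steadyDensity τ ⟨n, x, t⟩ =
      M.initialFactor P.initial (x 0) * Real.exp (P.cumEscape (x 0) (-τ)) *
        (∏ i, P.density (x i.castSucc) (x i.succ) (t i)) *
        (Real.exp (-P.cumEscape (x (Fin.last n)) τ) * M.finalFactor P.final (x (Fin.last n))) := by
  have hne : ∀ j : Fin n, x j.castSucc ≠ x j.succ := by
    simpa [jumpStates] using hx
  set ω : JumpPath S := ⟨n, x, t⟩ with hω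
  -- Summation by parts for the energy and for the integrated escape rate. The energy differences at
  -- the jumps cancel those in `psi`, exactly even for discontinuous protocols, since both use the
  -- parameters at the jump time; the escape differences are the gauge factors of `density`.
  have hwork := sum_node_sub τ ω fun u s => M.energy (M.nu (P.param s)) u
  have hesc := sum_node_sub τ ω P.cumEscape
  have hexp : P.weight τ ω = (∏ i : Fin n, M.rate (P.param (t i)) (x i.castSucc) (x i.succ)) *
      Real.exp (-∑ j : Fin (ω.jumps + 1), (P.cumEscape (ω.state j) (ω.node τ j.succ) -
        P.cumEscape (ω.state j) (ω.node τ j.castSucc))) := by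
    rw [weight, ← Real.exp_sum]
    simp only [P.integral_escapeRate, Finset.sum_neg_distrib]
    rfl
  have hdens : ∏ i : Fin n, P.density (x i.castSucc) (x i.succ) (t i) =
      (∏ i : Fin n, M.rate (P.param (t i)) (x i.castSucc) (x i.succ)) *
        Real.exp (∑ i : Fin n, (-M.theta (P.param (t i)) (x i.castSucc) (x i.succ) / 2 +
          (P.cumEscape (x i.succ) (t i) - P.cumEscape (x i.castSucc) (t i)))) := by
    rw [Real.exp_sum, ← Finset.prod_mul_distrib]
    refine Finset.prod_congr rfl fun i _ => ?_
    rw [density, ← M.rate_mul_exp_theta _ (hne i), Real.exp_add, mul_assoc]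
  have hent : P.entropyNoneq ω = ∑ i : Fin n, (M.theta (P.param (t i)) (x i.castSucc) (x i.succ) -
      M.beta * (M.energy (M.nu (P.param (t i))) (x i.castSucc) -
        M.energy (M.nu (P.param (t i))) (x i.succ))) := rfl
  rw [jarzynskiWeight, steadyDensity, hexp, hdens, work, hwork, hesc, hent, initialFactor,
    finalFactor, P.param_of_le (by linarith : -τ ≤ -P.tau0), P.param_of_ge hτ]
  have hs : ω.start = x 0 := rfl
  rw [hs]
  set R := ∏ i : Fin n, M.rate (P.param (t i)) (x i.castSucc) (x i.succ)
  set ρ := M.steadyState P.initial (x 0)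
  have hl : ∀ a b : ℝ, Real.exp a * (ρ * (R * Real.exp b)) = ρ * R * Real.exp (a + b) := by
    intro a b
    rw [Real.exp_add]
    ring
  have hr : ∀ a b c d e : ℝ, ρ * Real.exp a * Real.exp b * (R * Real.exp c) *
      (Real.exp d * Real.exp e) = ρ * R * Real.exp (a + b + c + d + e) := by
    intro a b c d e
    simp only [Real.exp_add]
    ring
  rw [hl, hr]
  congr 2
  simp only [Finset.sum_add_distrib, Finset.sum_sub_distrib, ← Finset.mul_sum, ← Finset.sum_div,
    Finset.sum_neg_distrib]
  ring

lemma steadyExp_jarzynskiWeight [Nonempty S] {τ : ℝ} (hτ : P.tau0 ≤ τ) :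
    P.SteadyIntegrable τ (P.jarzynskiWeight τ) ∧
      P.steadyExp τ (P.jarzynskiWeight τ) =
        P.kernelForm τ (M.initialFactor P.initial) (M.finalFactor P.final) := by
  obtain ⟨h1, h2⟩ := pathIntegral_of_eq_prod P.isTransitionDensity P.density_self
    (p := fun u => M.initialFactor P.initial u * Real.exp (P.cumEscape u (-τ)))
    (q := fun w => Real.exp (-P.cumEscape w τ) * M.finalFactor P.final w)
    (fun u => mul_nonneg (M.initialFactor_pos _ u).le (Real.exp_nonneg _))
    (fun w => mul_nonneg (Real.exp_nonneg _) (M.finalFactor_pos _ w).le) τ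
    (fun ω => P.jarzynskiWeight τ ω * P.steadyDensity τ ω)
    fun n x hx t => P.jarzynskiWeight_mul_steadyDensity hτ hx t
  refine ⟨h1, h2.trans ?_⟩
  refine Finset.sum_congr rfl fun u _ => Finset.sum_congr rfl fun w _ => ?_
  rw [kernel]
  ring

end Protocol

end Model

end NESS

/-! ### The main theorem -/

theorem theorem1 {S A N : Type*} [Fintype S] [DecidableEq S] [Nonempty S]
    (M : NESS.Model S A N) :
    ∃ F : A → ℝ,
      (∀ α : A, M.IsEquilibrium α →
        F α = -(1 / M.beta) *
          Real.log (∑ x : S, Real.exp (-M.beta * M.energy (M.nu α) x))) ∧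
      ∀ P : M.Protocol,
        (∀ τ : ℝ, P.tau0 ≤ τ →
          P.SteadyIntegrable τ (P.jarzynskiWeight τ) ∧
          P.reverse.SteadyIntegrable τ (P.reverse.jarzynskiWeight τ) ∧
          0 < P.steadyExp τ (P.jarzynskiWeight τ) ∧
          0 < P.reverse.steadyExp τ (P.reverse.jarzynskiWeight τ)) ∧
        Tendsto
          (fun τ : ℝ => -(1 / M.beta) *
            Real.log (P.steadyExp τ (P.jarzynskiWeight τ) /
              P.reverse.steadyExp τ (P.reverse.jarzynskiWeight τ)))
          atTop (𝓝 (F P.final - F P.initial)) := by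
  refine ⟨M.freeEnergy, fun α hα => M.freeEnergy_of_isEquilibrium hα, fun P => ⟨fun τ hτ => ?_, ?_⟩⟩
  · obtain ⟨h1, h2⟩ := P.steadyExp_jarzynskiWeight hτ
    obtain ⟨h3, h4⟩ := P.reverse.steadyExp_jarzynskiWeight hτ
    refine ⟨h1, h3, ?_, ?_⟩
    · rw [h2]
      exact P.sum_kernel_pos (M.initialFactor_pos _) (M.finalFactor_pos _) _ _
    · rw [h4]
      exact P.reverse.sum_kernel_pos (M.initialFactor_pos _) (M.finalFactor_pos _) _ _
  · obtain ⟨c, κ, hκ, hlim⟩ := P.tendsto_kernelForm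
    have hpos : ∀ (f : A → S → ℝ), (∀ α x, 0 < f α x) → ∀ α,
        0 < ∑ x, f α x * M.perronVector α x := fun f hf α =>
      Finset.sum_pos (fun x _ => mul_pos (hf α x) (M.perronVector_pos α x)) Finset.univ_nonempty
    have hu := hpos _ M.initialFactor_pos
    have hw := hpos _ M.finalFactor_pos
    set u := fun α => ∑ x, M.initialFactor α x * M.perronVector α x with hudef
    set w := fun α => ∑ x, M.finalFactor α x * M.perronVector α x with hwdef
    have h1 := hlim (M.initialFactor P.initial) (M.finalFactor P.final)
    -- The denominator is a form of the reversed kernel, hence of the original kernel with its two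
    -- arguments exchanged.
    have h2 := hlim (M.finalFactor P.initial) (M.initialFactor P.final)
    have hne : (w P.initial) * κ * u P.final ≠ 0 :=
      (mul_pos (mul_pos (hw P.initial) hκ) (hu P.final)).ne'
    have h3 := ((h1.div h2 hne).log (div_ne_zero
      (mul_pos (mul_pos (hu P.initial) hκ) (hw P.final)).ne' hne)).const_mul (-(1 / M.beta))
    have hval : -(1 / M.beta) * Real.log ((u P.initial * κ * w P.final) /
        (w P.initial * κ * u P.final)) = M.freeEnergy P.final - M.freeEnergy P.initial := by
      have hui := hu P.initial
      have huf := hu P.final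
      have hwi := hw P.initial
      have hwf := hw P.final
      rw [NESS.Model.freeEnergy, NESS.Model.freeEnergy]
      change _ = 1 / M.beta * Real.log (u P.final / w P.final) -
        1 / M.beta * Real.log (u P.initial / w P.initial)
      rw [Real.log_div (by positivity) (by positivity), Real.log_div huf.ne' hwf.ne',
        Real.log_div hui.ne' hwi.ne', Real.log_mul (by positivity) hwf.ne',
        Real.log_mul (by positivity) huf.ne', Real.log_mul hui.ne' hκ.ne',
        Real.log_mul hwi.ne' hκ.ne']
      ring
    rw [← hval]
    refine h3.congr' ?_
    -- The exponential normalization is common to both expectations and cancels for every `τ`.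
    filter_upwards [eventually_ge_atTop P.tau0] with τ hτ
    rw [(P.steadyExp_jarzynskiWeight hτ).2, (P.reverse.steadyExp_jarzynskiWeight hτ).2,
      P.kernelForm_reverse, P.reverse_final, P.reverse_initial, Pi.div_apply,
      mul_div_mul_left _ _ (Real.exp_ne_zero _)]
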